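/- **Setting.** Let $n\ge 1$. Let $\mathfrak h_n$ be the Heisenberg Lie algebra with basis $X_1,\dots,X_n,Y_1,\dots,Y_n,Z$, where $[X_i,Y_i]=Z$ and all other brackets of basis vectors vanish. Let $H_n$ be the simply connected Lie group of $\mathfrak h_n$, and put $\mathfrak v_0=\mathrm{Span}\{X_1,\dots,Y_n\}$. Let $P:H_n\to\mathfrak h_n\to\mathfrak v_0$ be the logarithm followed by the projection along $Z$. Write $\omega([U,V])$ for the $Z$-coefficient of $[U,V]$. Fix positive integers $\boldsymbol r=(r_1,\dots,r_n)$ with $r_i\mid r_{i+1}$, and let $\Gamma_{\boldsymbol r}<H_n$ be the lattice generated by $\exp(r_iX_i)$, $\exp(Y_i)$ $(1\le i\le n)$ and $\exp Z$. **Metrics.** For $k\in\{0,1\}$ let $\mathcal A_k$ be the set of linear maps $A:\mathfrak h_n\to\mathfrak h_n$ such that $\ker A$ is spanned by $k$ of the basis vectors and $\mathrm{Im}A$ is bracket generating. Such an $A$ defines a left invariant (sub-)Riemannian structure: the distribution is $\mathrm{Im}A$, and $\langle\cdot,\cdot\rangle_A$ is the inner product on $\mathrm{Im}A$ for which the nonzero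 vectors among $AX_1,\dots,AY_n,AZ$ are orthonormal. Let $\|\cdot\|_A$ be its norm and $dist_A$ the induced distance on $\Gamma_{\boldsymbol r}\backslash H_n$. The *minimal Popp's volume form* $v(A)$ is the minimum (up to sign, with respect to a fixed Haar volume form) of the Popp's volume forms of the structures $(\mathfrak w,\langle\cdot,\cdot\rangle_A|_{\mathfrak w})$, where $\mathfrak w$ runs over the bracket generating subspaces of $\mathrm{Im}A$. The Popp's volume form of $(\mathfrak w,\langle\cdot,\cdot\rangle)$ is the form induced from the inner product on $\mathfrak w\oplus\mathfrak h_n/\mathfrak w$ which is the given one on $\mathfrak w$, and on $\mathfrak h_n/\mathfrak w$ the quotient of the inner product of $\mathfrak w\otimes\mathfrak w$ under $u\otimes v\mapsto[u,v]\bmod\mathfrak w$. **Canonical form.** Identify linear maps of $\mathfrak h_n$ with matrices in the basis $X_1,\dots,Y_n,Z$. A *weak canonical form* of $A\in\mathcal A_0\cup\mathcal A_1$ is a matrix $$B=PAR=\begin{pmatrix}\tilde A&0\\0&\rho_A\end{pmatrix}$$ with $P$ the differential of an inner automorphism of $H_n$, $R\in O(2n+1)$, $\tilde A\in GL_{2n}(\mathbb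 R)$ and $\rho_A\in\mathbb R$. Let $j_A:\mathfrak v_0\to\mathfrak v_0$ be the operator with $\langle j_A(U),V\rangle_B=\omega([U,V])$ for all $U,V\in\mathfrak v_0$. Its eigenvalues are $\pm\sqrt{-1}\,d_1(A),\dots,\pm\sqrt{-1}\,d_n(A)$ with $0<d_1(A)\le\dots\le d_n(A)$. **Proposition.** For all $D,V>0$ there are constants $C_1,C_2,C_3,C_+>0$, depending only on $n,\boldsymbol r,D,V$, such that the following holds. Let $A\in\mathcal A_0\cup\mathcal A_1$ satisfy $$\mathrm{diam}(\Gamma_{\boldsymbol r}\backslash H_n,dist_A)\le D\qquad\text{and}\qquad\Big|\int_{\Gamma_{\boldsymbol r}\backslash H_n}v(A)\Big|\ge V .$$ Then for every weak canonical form $B$ of $A$, with blocks $\tilde A$ and $\rho_A$: * (A-1) $\min\{\|X\|_B : X\in P(\Gamma_{\boldsymbol r}),\ X\ne0\}\ge C_1$; * (A-2) $|\det\tilde A|\ge C_2$; * (A-3) $d_n(A)\le C_3$; * (A-4)' $|\rho_A|\le C_+$. -/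

import Mathlib

open scoped ENNReal Matrix
open MeasureTheory

namespace HeisenbergModuli

noncomputable section

/-- Index set of the basis `X₁, …, Xₙ, Y₁, …, Yₙ` of the horizontal space `𝔳₀`. -/
abbrev HIdx (n : ℕ) : Type := Fin n ⊕ Fin n

/-- Index set of the basis `X₁, …, Xₙ, Y₁, …, Yₙ, Z` of the Heisenberg Lie algebra. -/
abbrev Idx (n : ℕ) : Type := HIdx n ⊕ Unit

/-- The `(2n+1)`-dimensional Heisenberg Lie algebra, in coordinates with respect to
`X₁, …, Xₙ, Y₁, …, Yₙ, Z`. -/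
abbrev HeisAlg (n : ℕ) : Type := Idx n → ℝ

/-- The subspace `𝔳₀ = Span {X₁, …, Xₙ, Y₁, …, Yₙ}` in coordinates. -/
abbrev Horiz (n : ℕ) : Type := HIdx n → ℝ

/-- The basis vector of the Lie algebra with index `i`. -/
def basisVec {n : ℕ} (i : Idx n) : HeisAlg n := Pi.single i 1

/-- The basis vector `Xᵢ`. -/
def vecX {n : ℕ} (i : Fin n) : HeisAlg n := basisVec (Sum.inl (Sum.inl i))

/-- The basis vector `Yᵢ`. -/
def vecY {n : ℕ} (i : Fin n) : HeisAlg n := basisVec (Sum.inl (Sum.inr i))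

/-- The central basis vector `Z`. -/
def vecZ {n : ℕ} : HeisAlg n := basisVec (Sum.inr ())

/-- The projection of the Lie algebra onto `𝔳₀` along `Z`. -/
def horizPart {n : ℕ} (u : HeisAlg n) : Horiz n := fun i => u (Sum.inl i)

/-- The inclusion of `𝔳₀` into the Lie algebra. -/
def horizIncl {n : ℕ} (x : Horiz n) : HeisAlg n := Sum.elim x (fun _ => 0)

/-- The symplectic form `ω([u, v])`, i.e. the `Z`-coefficient of `[u, v]`. -/
def symp {n : ℕ} (u v : HeisAlg n) : ℝ :=
  ∑ i : Fin n, (u (Sum.inl (Sum.inl i)) * v (Sum.inl (Sum.inr i))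
    - u (Sum.inl (Sum.inr i)) * v (Sum.inl (Sum.inl i)))

/-- The Lie bracket: `[Xᵢ, Yᵢ] = Z`, and all other brackets of basis vectors vanish. -/
def bracket {n : ℕ} (u v : HeisAlg n) : HeisAlg n := symp u v • vecZ

/-- The Heisenberg Lie group `Hₙ`. The exponential map is a bijection, and every group element is
written as `exp u` for a unique `u` in the Lie algebra. -/
@[ext] structure Heis (n : ℕ) where
  /-- the exponential map -/
  exp ::
  /-- the logarithm -/
  log : HeisAlg n

theorem symp_add_left {n : ℕ} (u v w : HeisAlg n) : symp (u + v) w = symp u w + symp v w := by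
  simp only [symp, Pi.add_apply, ← Finset.sum_add_distrib]
  exact Finset.sum_congr rfl fun i _ => by ring

theorem symp_add_right {n : ℕ} (u v w : HeisAlg n) : symp u (v + w) = symp u v + symp u w := by
  simp only [symp, Pi.add_apply, ← Finset.sum_add_distrib]
  exact Finset.sum_congr rfl fun i _ => by ring

theorem symp_smul_vecZ_left {n : ℕ} (c : ℝ) (u : HeisAlg n) : symp (c • vecZ) u = 0 := by
  simp [symp, vecZ, basisVec]

theorem symp_smul_vecZ_right {n : ℕ} (c : ℝ) (u : HeisAlg n) : symp u (c • vecZ) = 0 := by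
  simp [symp, vecZ, basisVec]

theorem symp_neg_self {n : ℕ} (u : HeisAlg n) : symp (-u) u = 0 := by
  simp only [symp, Pi.neg_apply]
  exact Finset.sum_eq_zero fun i _ => by ring

/-- The group law of `Hₙ`: `exp u * exp v = exp (u + v + ½ [u, v])`. -/
instance {n : ℕ} : Mul (Heis n) :=
  ⟨fun p q => Heis.exp (p.log + q.log + (1 / 2 : ℝ) • bracket p.log q.log)⟩

instance {n : ℕ} : One (Heis n) := ⟨Heis.exp 0⟩

instance {n : ℕ} : Inv (Heis n) := ⟨fun p => Heis.exp (-p.log)⟩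

theorem log_mul {n : ℕ} (p q : Heis n) :
    (p * q).log = p.log + q.log + (1 / 2 : ℝ) • bracket p.log q.log := rfl

theorem log_one {n : ℕ} : (1 : Heis n).log = 0 := rfl

theorem log_inv {n : ℕ} (p : Heis n) : (p⁻¹).log = -p.log := rfl

instance {n : ℕ} : Group (Heis n) :=
  Group.ofLeftAxioms
    (fun p q s => by
      apply Heis.ext
      simp only [log_mul, bracket, smul_smul, symp_add_left, symp_add_right,
        symp_smul_vecZ_left, symp_smul_vecZ_right]
      module)
    (fun p => by
      apply Heis.ext
      simp [log_mul, log_one, bracket, symp])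
    (fun p => by
      apply Heis.ext
      simp [log_mul, log_one, log_inv, bracket, symp_neg_self])

/-- The Borel σ-algebra of `Hₙ ≅ ℝ²ⁿ⁺¹`. -/
instance {n : ℕ} : MeasurableSpace (Heis n) := MeasurableSpace.comap Heis.log inferInstance

/-- The Haar measure of `Hₙ` given by the left invariant volume form
`X₁* ∧ ⋯ ∧ Xₙ* ∧ Y₁* ∧ ⋯ ∧ Yₙ* ∧ Z*`; in exponential coordinates it is the Lebesgue measure. -/
def haar (n : ℕ) : Measure (Heis n) := Measure.map Heis.exp volume

/-- The tuples `r = (r₁, …, rₙ)` of positive integers with `r₁ ∣ r₂ ∣ ⋯ ∣ rₙ`. -/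
def IsLatticeType {n : ℕ} (r : Fin n → ℕ) : Prop :=
  (∀ i, 0 < r i) ∧ ∀ i j, i ≤ j → r i ∣ r j

/-- The lattice `Γ_r` generated by `r₁X₁, …, rₙXₙ, Y₁, …, Yₙ, Z`. -/
def lattice {n : ℕ} (r : Fin n → ℕ) : Subgroup (Heis n) :=
  Subgroup.closure
    (Set.range (fun i => Heis.exp ((r i : ℝ) • vecX i)) ∪ Set.range (fun i => Heis.exp (vecY i))
      ∪ {Heis.exp vecZ})

/-- The image `P(Γ_r)` of the lattice under `P : Hₙ → 𝔥ₙ → 𝔳₀`. -/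
def projLattice {n : ℕ} (r : Fin n → ℕ) : Set (Horiz n) :=
  (fun γ : Heis n => horizPart γ.log) '' (lattice r : Set (Heis n))

/-- The compact Heisenberg manifold `Γ_r \ Hₙ`. -/
abbrev CompactHeis {n : ℕ} (r : Fin n → ℕ) : Type := Quotient (QuotientGroup.rightRel (lattice r))

/-! ### Left invariant sub-Riemannian structures -/

/-- `𝔴¹ = 𝔴`, `𝔴ⁱ⁺¹ = 𝔴ⁱ + [𝔴, 𝔴ⁱ]` (indexed from `0`). -/
def bracketFlag {n : ℕ} (w : Submodule ℝ (HeisAlg n)) : ℕ → Submodule ℝ (HeisAlg n)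
  | 0 => w
  | k + 1 => bracketFlag w k ⊔ Submodule.span ℝ {x | ∃ u ∈ w, ∃ v ∈ bracketFlag w k, x = bracket u v}

/-- A subspace of the Lie algebra is bracket generating. -/
def BracketGenerating {n : ℕ} (w : Submodule ℝ (HeisAlg n)) : Prop := ∃ k, bracketFlag w k = ⊤

/-- The image of the linear transformation given by the matrix `A`. -/
def im {n : ℕ} (A : Matrix (Idx n) (Idx n) ℝ) : Submodule ℝ (HeisAlg n) :=
  LinearMap.range A.mulVecLin

/-- The family `𝒜ₖ` of linear transformations of corank `k` whose kernel is spanned by `k` of the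
basis vectors and whose image is bracket generating. -/
def metricMatrices (n k : ℕ) : Set (Matrix (Idx n) (Idx n) ℝ) :=
  {A | (∃ I : Finset (Idx n), I.card = k ∧
      LinearMap.ker A.mulVecLin = Submodule.span ℝ (basisVec '' (I : Set (Idx n)))) ∧
    BracketGenerating (im A)}

open Classical in
/-- For `u ∈ Im A`, the coordinates of `u` in the basis of `Im A` formed by the nonzero vectors
among the images under `A` of the basis vectors (with coordinate `0` at the other indices). -/
def imCoords {n : ℕ} (A : Matrix (Idx n) (Idx n) ℝ) (u : HeisAlg n) : Idx n → ℝ :=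
  if h : ∃ ξ : Idx n → ℝ, (∀ i, A *ᵥ basisVec i = 0 → ξ i = 0) ∧ A *ᵥ ξ = u then h.choose else 0

/-- The inner product `⟨u, v⟩_A` on `Im A` for which the nonzero vectors among
`AX₁, …, AYₙ, AZ` are an orthonormal basis. -/
def metricInner {n : ℕ} (A : Matrix (Idx n) (Idx n) ℝ) (u v : HeisAlg n) : ℝ :=
  imCoords A u ⬝ᵥ imCoords A v

/-- The norm `‖u‖_A` on `Im A`. -/
def metricNorm {n : ℕ} (A : Matrix (Idx n) (Idx n) ℝ) (u : HeisAlg n) : ℝ :=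
  √(metricInner A u u)

/-! ### The distance -/

/-- The differential at the identity of the left translation by `exp p`, applied to `u`, in
exponential coordinates: the derivative at `s = 0` of `log (exp p * exp (s u))`. -/
def leftTranslate {n : ℕ} (p u : HeisAlg n) : HeisAlg n := u + (1 / 2 : ℝ) • bracket p u

/-- The curve `t ↦ exp (c t)`, `t ∈ [0, 1]`, is absolutely continuous, and for almost every `t` its
velocity is the left translate of `u t ∈ Im A`. -/
structure IsAdmissible {n : ℕ} (A : Matrix (Idx n) (Idx n) ℝ) (c u : ℝ → HeisAlg n) : Prop where
  absCont : AbsolutelyContinuousOnInterval c 0 1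
  velocity : ∀ᵐ t ∂(volume.restrict (Set.Icc (0 : ℝ) 1)),
    HasDerivAt c (leftTranslate (c t) (u t)) t ∧ u t ∈ im A

/-- The length of an admissible curve with left-trivialized velocity `u`. -/
def length {n : ℕ} (A : Matrix (Idx n) (Idx n) ℝ) (u : ℝ → HeisAlg n) : ℝ≥0∞ :=
  ∫⁻ t in Set.Icc (0 : ℝ) 1, ENNReal.ofReal (metricNorm A (u t))

/-- The sub-Riemannian distance on `Hₙ` of the left invariant structure `(Im A, ⟨·,·⟩_A)`. -/
def subRiemDist {n : ℕ} (A : Matrix (Idx n) (Idx n) ℝ) (p q : Heis n) : ℝ≥0∞ :=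
  ⨅ (c : ℝ → HeisAlg n) (u : ℝ → HeisAlg n) (_ : IsAdmissible A c u) (_ : c 0 = p.log)
    (_ : c 1 = q.log), length A u

/-- The sub-Riemannian distance on `Γ_r \ Hₙ`: every admissible curve of the quotient lifts, so it
is the infimum of the distances between representatives. -/
def quotDist {n : ℕ} (A : Matrix (Idx n) (Idx n) ℝ) (r : Fin n → ℕ) (a b : CompactHeis r) : ℝ≥0∞ :=
  ⨅ (p : Heis n) (q : Heis n) (_ : Quotient.mk _ p = a) (_ : Quotient.mk _ q = b), subRiemDist A p q

/-- The diameter of `Γ_r \ Hₙ`. -/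
def diameter {n : ℕ} (A : Matrix (Idx n) (Idx n) ℝ) (r : Fin n → ℕ) : ℝ≥0∞ :=
  ⨆ (a : CompactHeis r) (b : CompactHeis r), quotDist A r a b

/-! ### Popp's volume and the minimal Popp's volume -/

/-- Let `b i`, `i ∈ S`, be an orthonormal basis of `𝔴`. The square of the norm induced on
`(𝔴 + [𝔴, 𝔴]) / 𝔴` by the Hilbert space `𝔴 ⊗ 𝔴` through the surjection `u ⊗ v ↦ [u, v] mod 𝔴`:
the least squared norm of a tensor `∑ aᵢⱼ bᵢ ⊗ bⱼ` which is mapped to the class of `z`. -/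
def quotNormSq {n : ℕ} (w : Submodule ℝ (HeisAlg n)) (S : Finset (Idx n))
    (b : Idx n → HeisAlg n) (z : HeisAlg n) : ℝ :=
  sInf {x | ∃ a : Idx n → Idx n → ℝ,
    (∑ i ∈ S, ∑ j ∈ S, a i j • bracket (b i) (b j)) - z ∈ w ∧ x = ∑ i ∈ S, ∑ j ∈ S, a i j ^ 2}

/-- `b` is a basis of the Lie algebra such that the `b i` with `i ∈ S` form an orthonormal basis of
`(𝔴, ⟨·,·⟩_A)` and the classes of the others form an orthonormal basis of the second layer `𝔥ₙ / 𝔴`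
of the nilpotentization, with the inner product induced from `𝔴 ⊗ 𝔴`. -/
structure IsPoppFrame {n : ℕ} (A : Matrix (Idx n) (Idx n) ℝ) (w : Submodule ℝ (HeisAlg n))
    (S : Finset (Idx n)) (b : Idx n → HeisAlg n) : Prop where
  linearIndependent : LinearIndependent ℝ b
  span_eq : Submodule.span ℝ (b '' (S : Set (Idx n))) = w
  orthonormal : ∀ i ∈ S, ∀ j ∈ S, metricInner A (b i) (b j) = if i = j then 1 else 0
  quot_orthonormal : ∀ t : Idx n → ℝ, quotNormSq w S b (∑ i ∈ Sᶜ, t i • b i) = ∑ i ∈ Sᶜ, t i ^ 2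

/-- Popp's volume form of the left invariant structure `(𝔴, ⟨·,·⟩_A|_𝔴)` is, up to sign,
`κ X₁* ∧ ⋯ ∧ Yₙ* ∧ Z*`: it takes the values `±1` on the frames above. -/
def IsPoppDensity {n : ℕ} (A : Matrix (Idx n) (Idx n) ℝ) (w : Submodule ℝ (HeisAlg n))
    (κ : ℝ) : Prop :=
  ∃ (S : Finset (Idx n)) (b : Idx n → HeisAlg n), IsPoppFrame A w S b ∧ κ = |(Matrix.of b).det|⁻¹

/-- The coefficient of the minimal Popp's volume form with respect to `X₁* ∧ ⋯ ∧ Yₙ* ∧ Z*`: the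
minimum of Popp's volumes of the bracket generating subspaces of `Im A`. -/
def minPoppDensity {n : ℕ} (A : Matrix (Idx n) (Idx n) ℝ) : ℝ :=
  sInf {κ | ∃ w : Submodule ℝ (HeisAlg n), w ≤ im A ∧ BracketGenerating w ∧ IsPoppDensity A w κ}

/-- The measure on `Hₙ` given by the minimal Popp's volume form. -/
def minPoppMeasure {n : ℕ} (A : Matrix (Idx n) (Idx n) ℝ) : Measure (Heis n) :=
  ENNReal.ofReal (minPoppDensity A) • haar n

/-- The total measure of `Γ_r \ Hₙ` in the minimal Popp's volume form: the measure of a fundamental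
domain of the action of `Γ_r` on `Hₙ` by left translations. -/
def totalMinPopp {n : ℕ} (A : Matrix (Idx n) (Idx n) ℝ) (r : Fin n → ℕ) : ℝ≥0∞ :=
  covolume (lattice r) (Heis n) (minPoppMeasure A)

/-! ### Canonical forms and the `j`-operator -/

/-- `P` is the matrix of the differential of an inner automorphism of `Hₙ`. -/
def IsInnerDifferential {n : ℕ} (P : Matrix (Idx n) (Idx n) ℝ) : Prop :=
  ∃ g : Heis n, ∀ u : HeisAlg n, Heis.exp (P *ᵥ u) = g * Heis.exp u * g⁻¹

/-- The matrix in weak canonical form with blocks `Ã` and `ρ`. -/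
def weakCanonical {n : ℕ} (At : Matrix (HIdx n) (HIdx n) ℝ) (ρ : ℝ) : Matrix (Idx n) (Idx n) ℝ :=
  Matrix.fromBlocks At 0 0 (Matrix.of fun _ _ => ρ)

/-- `weakCanonical Ã ρ` is a representative of `A` in weak canonical form, i.e. it equals `P A R`
with `P` in `Inn(Hₙ)_*` and `R` orthogonal, and `Ã` is invertible. -/
def IsWeakCanonicalFormOf {n : ℕ} (A : Matrix (Idx n) (Idx n) ℝ)
    (At : Matrix (HIdx n) (HIdx n) ℝ) (ρ : ℝ) : Prop :=
  At.det ≠ 0 ∧ ∃ P R : Matrix (Idx n) (Idx n) ℝ, IsInnerDifferential P ∧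
    R ∈ Matrix.orthogonalGroup (Idx n) ℝ ∧ P * A * R = weakCanonical At ρ

/-- `j` is the matrix, in the basis `X₁, …, Yₙ`, of the operator `j_B : 𝔳₀ → 𝔳₀` defined by
`⟨j_B U, V⟩_B = ω([U, V])`. -/
def IsJOperator {n : ℕ} (B : Matrix (Idx n) (Idx n) ℝ) (j : Matrix (HIdx n) (HIdx n) ℝ) : Prop :=
  ∀ U V : Horiz n,
    metricInner B (horizIncl (j *ᵥ U)) (horizIncl V) = symp (horizIncl U) (horizIncl V)

/-- `d` is the number `dₙ`: the largest real number such that `√-1 d` is an eigenvalue of `j`. -/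
def IsTopFrequency {n : ℕ} (j : Matrix (HIdx n) (HIdx n) ℝ) (d : ℝ) : Prop :=
  IsGreatest {x : ℝ | Module.End.HasEigenvalue
    (Matrix.toLin' (j.map (fun y : ℝ => (y : ℂ)))) ((x : ℂ) * Complex.I)} d

end

end HeisenbergModuli

namespace HeisenbergModuli

/-! ### The lattice -/

/-! The columns of `At` form a frame of 𝔳₀, and everything is measured in it: `frameNorm At` is the
Euclidean norm of frame coordinates, and `formNorm At` is the Hilbert–Schmidt norm of ω in the
frame. Three inputs are combined.

Diameter. Projecting to 𝔳₀ does not increase lengths (`frameNorm_sub_le_length`), so every point of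
𝔳₀ lies within 2D of P(Γ) (`exists_frameNorm_sub_lt`). Consequently no hyperplane contains all
lattice vectors of norm at most 6D (`exists_mem_projLattice_dotProduct_ne_zero`). Lattice vectors
have integer coordinates, so a basis made of such short vectors has a nonzero integer determinant.
Since the frame coordinates are bounded by 6D, this bounds |det Ã| from below
(`one_le_abs_det_mul`), which is (A-2).

Volume. A minimum is bounded by any competitor. The whole algebra (if ρ ≠ 0) has Popp density
1/(|det Ã| |ρ|), and the horizontal space, transported by the inner differential, has density
1/(|det Ã| ‖ω‖). The total volume is at most the density times the Haar measure of a box covering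
the quotient (`totalMinPopp_le`). With (A-2), the lower bound V therefore bounds both |ρ| and ‖ω‖
from above. The first bound is (A-4)'. The second gives (A-3), because `j` is conjugate to the
transposed matrix of ω in the frame, whose eigenvalues are bounded by its Hilbert–Schmidt norm.

Integrality of ω. For a nonzero lattice vector x, the functional ω(x, ·) is nonzero, hence nonzero
at some lattice vector l of norm at most 6D. There it is an integer, so 1 ≤ |ω(x, l)| ≤ ‖ω‖ |x| 6D
(`one_le_formNorm_mul`). With ‖ω‖ bounded, this is (A-1). -/

theorem exists_int_coords_of_mem_lattice {n : ℕ} {r : Fin n → ℕ} {γ : Heis n}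
    (hγ : γ ∈ lattice r) :
    ∃ k : Idx n → ℤ, (∀ i, γ.log (Sum.inl i) = k (Sum.inl i)) ∧
      γ.log (Sum.inr ()) = (k (Sum.inr ()) : ℝ) / 2 := by
  induction hγ using Subgroup.closure_induction with
  | mem x hx =>
    rcases hx with (⟨i, rfl⟩ | ⟨i, rfl⟩) | hx
    · refine ⟨Pi.single (Sum.inl (Sum.inl i)) (r i : ℤ), fun j => ?_, ?_⟩
      · simp [vecX, basisVec, Pi.single_apply]
      · simp [vecX, basisVec]
    · refine ⟨Pi.single (Sum.inl (Sum.inr i)) 1, fun j => ?_, ?_⟩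
      · simp [vecY, basisVec, Pi.single_apply]
      · simp [vecY, basisVec]
    · rw [Set.mem_singleton_iff] at hx
      subst hx
      refine ⟨Pi.single (Sum.inr ()) 2, fun j => ?_, ?_⟩
      · simp [vecZ, basisVec]
      · simp [vecZ, basisVec]
  | one => exact ⟨0, by simp [log_one], by simp [log_one]⟩
  | mul x y _ _ hx hy =>
    obtain ⟨k, hk, hk'⟩ := hx
    obtain ⟨l, hl, hl'⟩ := hy
    -- The term ½[u, v] of the group law has integral [u, v], so the central coordinate stays in ½ℤ.
    refine ⟨Sum.elim (fun i => k (Sum.inl i) + l (Sum.inl i)) (fun _ => k (Sum.inr ()) + l (Sum.inr ())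
      + ∑ i : Fin n, (k (Sum.inl (Sum.inl i)) * l (Sum.inl (Sum.inr i))
        - k (Sum.inl (Sum.inr i)) * l (Sum.inl (Sum.inl i)))), fun i => ?_, ?_⟩
    · simp [log_mul, bracket, vecZ, basisVec, hk, hl]
    · simp only [log_mul, bracket, vecZ, basisVec, symp, Pi.add_apply, Pi.smul_apply, hk, hl, hk', hl',
        Pi.single_eq_same, Sum.elim_inr, smul_eq_mul]
      push_cast
      ring
  | inv x _ hx =>
    obtain ⟨k, hk, hk'⟩ := hx
    exact ⟨-k, by simp [log_inv, hk], by simp [log_inv, hk', neg_div]⟩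

instance countable_lattice {n : ℕ} (r : Fin n → ℕ) : Countable (lattice r) := by
  choose k hk hk' using fun γ : lattice r => exists_int_coords_of_mem_lattice γ.2
  refine Function.Injective.countable (f := k) fun γ δ h => ?_
  apply Subtype.ext
  apply Heis.ext
  funext i
  rcases i with i | ⟨⟩
  · rw [hk, hk, h]
  · rw [hk', hk', h]

theorem horizPart_log_mul {n : ℕ} (p q : Heis n) :
    horizPart (p * q).log = horizPart p.log + horizPart q.log := by
  funext i
  simp [horizPart, log_mul, bracket, vecZ, basisVec]

theorem horizPart_log_inv {n : ℕ} (p : Heis n) : horizPart (p⁻¹).log = -horizPart p.log := rfl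

/-- The image of the lattice in the horizontal space, as an additive subgroup. -/
def projSubgroup {n : ℕ} (r : Fin n → ℕ) : AddSubgroup (Horiz n) where
  carrier := projLattice r
  zero_mem' := ⟨1, one_mem _, rfl⟩
  add_mem' := by
    rintro _ _ ⟨p, hp, rfl⟩ ⟨q, hq, rfl⟩
    exact ⟨p * q, mul_mem hp hq, horizPart_log_mul p q⟩
  neg_mem' := by
    rintro _ ⟨p, hp, rfl⟩
    exact ⟨p⁻¹, inv_mem hp, rfl⟩

theorem mem_projSubgroup {n : ℕ} {r : Fin n → ℕ} {x : Horiz n} :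
    x ∈ projSubgroup r ↔ x ∈ projLattice r := Iff.rfl

theorem exists_int_of_mem_projLattice {n : ℕ} {r : Fin n → ℕ} {x : Horiz n}
    (hx : x ∈ projLattice r) : ∃ k : HIdx n → ℤ, ∀ i, x i = k i := by
  obtain ⟨γ, hγ, rfl⟩ := hx
  obtain ⟨k, hk, -⟩ := exists_int_coords_of_mem_lattice hγ
  exact ⟨fun i => k (Sum.inl i), hk⟩

theorem single_mem_projLattice {n : ℕ} (r : Fin n → ℕ) (i : HIdx n) :
    (Pi.single i (Sum.elim (fun i => (r i : ℝ)) 1 i) : Horiz n) ∈ projLattice r := by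
  rcases i with i | i
  · refine ⟨Heis.exp ((r i : ℝ) • vecX i),
      Subgroup.subset_closure (Or.inl (Or.inl ⟨i, rfl⟩)), ?_⟩
    funext j
    simp [horizPart, vecX, basisVec, Pi.single_apply]
  · refine ⟨Heis.exp (vecY i), Subgroup.subset_closure (Or.inl (Or.inr ⟨i, rfl⟩)), ?_⟩
    funext j
    simp [horizPart, vecY, basisVec, Pi.single_apply]

/-- Round each coordinate down by a multiple of its generator, which has length `r i` along Xᵢ and 1
along Yᵢ. -/
theorem exists_mem_projLattice_add_mem_Icc {n : ℕ} {r : Fin n → ℕ} (hr : ∀ i, 0 < r i)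
    (x : Horiz n) : ∃ l ∈ projLattice r, ∀ i, (l + x) i ∈
      Set.Icc (0 : ℝ) (Sum.elim (fun i => (r i : ℝ)) 1 i) := by
  set m : HIdx n → ℝ := Sum.elim (fun i => (r i : ℝ)) 1 with hm
  have hpos : ∀ i, 0 < m i := by
    rintro (i | i)
    · simpa [hm] using hr i
    · simp [hm]
  refine ⟨∑ i, (-⌊x i / m i⌋) • Pi.single i (m i), ?_, fun i => ?_⟩
  · exact mem_projSubgroup.1 (sum_mem fun i _ => zsmul_mem (single_mem_projLattice r i) _)
  · have h1 : (∑ j, (-⌊x j / m j⌋) • (Pi.single j (m j) : Horiz n)) i = -⌊x i / m i⌋ * m i := by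
      simp [Finset.sum_apply, Pi.single_apply]
    rw [Pi.add_apply, h1]
    have h2 := Int.floor_le (x i / m i)
    have h3 := (Int.lt_floor_add_one (x i / m i)).le
    rw [le_div_iff₀ (hpos i)] at h2
    rw [div_le_iff₀ (hpos i)] at h3
    constructor <;> linarith

theorem log_exp_zsmul_vecZ_mul {n : ℕ} (c : ℤ) (p : Heis n) :
    ((Heis.exp vecZ) ^ c * p).log = (c : ℝ) • vecZ + p.log := by
  have h1 (q : Heis n) : (Heis.exp vecZ * q).log = vecZ + q.log := by
    have := symp_smul_vecZ_left 1 q.log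
    rw [one_smul] at this
    simp [log_mul, bracket, this]
  have h2 (q : Heis n) : ((Heis.exp vecZ)⁻¹ * q).log = -vecZ + q.log := by
    have := h1 ((Heis.exp vecZ)⁻¹ * q)
    rw [mul_inv_cancel_left] at this
    rw [this]
    abel
  induction c with
  | zero => simp
  | succ i ih =>
    rw [add_comm, zpow_add, zpow_one, mul_assoc, h1, ih]
    push_cast
    module
  | pred i ih =>
    rw [sub_eq_add_neg, add_comm, zpow_add, zpow_neg_one, mul_assoc, h2, ih]
    push_cast
    module

/-- A box in exponential coordinates whose translates under the lattice cover the group. -/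
def coveringBox {n : ℕ} (r : Fin n → ℕ) : Set (Heis n) :=
  Heis.log ⁻¹' Set.Icc 0 (Sum.elim (Sum.elim (fun i => (r i : ℝ)) 1) 1)

theorem exists_mul_mem_coveringBox {n : ℕ} {r : Fin n → ℕ} (hr : ∀ i, 0 < r i) (p : Heis n) :
    ∃ γ ∈ lattice r, γ * p ∈ coveringBox r := by
  obtain ⟨_, ⟨γ, hγ, rfl⟩, hl⟩ := exists_mem_projLattice_add_mem_Icc hr (horizPart p.log)
  set q := γ * p with hq
  have hZ : Heis.exp vecZ ∈ lattice r := Subgroup.subset_closure (Or.inr rfl)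
  -- Horizontal coordinates are reduced first. The central correction comes last, as multiplying by
  -- a power of exp Z leaves them unchanged.
  refine ⟨(Heis.exp vecZ) ^ (-⌊q.log (Sum.inr ())⌋) * γ, mul_mem (zpow_mem hZ _) hγ, ?_⟩
  rw [mul_assoc, ← hq, coveringBox, Set.mem_preimage, log_exp_zsmul_vecZ_mul]
  have hh : ∀ i, q.log (Sum.inl i) ∈ Set.Icc (0 : ℝ) (Sum.elim (fun i => (r i : ℝ)) 1 i) := by
    intro i
    have := hl i
    simp only at this
    rwa [← horizPart_log_mul] at this
  refine ⟨fun i => ?_, fun i => ?_⟩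
  · rcases i with i | i
    · simpa [vecZ, basisVec] using (hh i).1
    · have := Int.floor_le (q.log (Sum.inr ()))
      simpa [vecZ, basisVec] using this
  · rcases i with i | i
    · simpa [vecZ, basisVec] using (hh i).2
    · have := (Int.lt_floor_add_one (q.log (Sum.inr ()))).le
      simp [vecZ, basisVec]
      linarith

/-! ### Invariance of the Haar measure and the covolume of the lattice -/

theorem measurable_log {n : ℕ} : Measurable (Heis.log : Heis n → HeisAlg n) :=
  comap_measurable _

theorem measurable_exp {n : ℕ} : Measurable (Heis.exp : HeisAlg n → Heis n) :=
  measurable_comap_iff.2 measurable_id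

theorem haar_apply {n : ℕ} {s : Set (Heis n)} (hs : MeasurableSet s) :
    haar n s = volume (Heis.exp ⁻¹' s) := by
  rw [haar, Measure.map_apply measurable_exp hs]

theorem haar_coveringBox_lt_top {n : ℕ} (r : Fin n → ℕ) : haar n (coveringBox r) < ∞ := by
  rw [coveringBox, haar_apply (measurable_log measurableSet_Icc)]
  exact isCompact_Icc.measure_lt_top

/-- The linear map `u ↦ u + c [g, u]`. -/
def shear {n : ℕ} (g : HeisAlg n) (c : ℝ) : HeisAlg n →ₗ[ℝ] HeisAlg n where
  toFun u := u + c • bracket g u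
  map_add' u v := by
    simp only [bracket, symp_add_right]
    module
  map_smul' a u := by
    have : symp g (a • u) = a * symp g u := by
      simp only [symp, Finset.mul_sum, Pi.smul_apply, smul_eq_mul]
      exact Finset.sum_congr rfl fun i _ => by ring
    simp only [bracket, this, RingHom.id_apply]
    module

theorem shear_apply {n : ℕ} (g : HeisAlg n) (c : ℝ) (u : HeisAlg n) :
    shear g c u = u + c • bracket g u := rfl

/-- The map is unipotent: brackets are central and kill the centre, so its matrix is block
triangular with identity diagonal blocks. -/
theorem det_shear {n : ℕ} (g : HeisAlg n) (c : ℝ) : LinearMap.det (shear g c) = 1 := by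
  rw [← LinearMap.det_toMatrix']
  have : LinearMap.toMatrix' (shear g c) = Matrix.fromBlocks 1 0
      (Matrix.of fun _ j => c * symp g (basisVec (Sum.inl j))) 1 := by
    ext i j
    rw [LinearMap.toMatrix'_apply]
    have hj : (fun j' => if j' = j then (1 : ℝ) else 0) = basisVec j := by
      funext k
      simp [basisVec, Pi.single_apply]
    rcases i with i | i <;> rcases j with j | j
    · simp [shear_apply, bracket, vecZ, basisVec, Matrix.one_apply, Pi.single_apply]
    · simp [shear_apply, bracket, vecZ, basisVec]
    · simp [shear_apply, bracket, vecZ, basisVec]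
    · have := symp_smul_vecZ_right 1 g
      rw [one_smul] at this
      simp only [vecZ, basisVec] at this
      simp [shear_apply, bracket, vecZ, basisVec, this]
  rw [this, Matrix.det_fromBlocks_zero₁₂]
  simp

/-- In exponential coordinates, left translation is a unimodular shear followed by a Euclidean
translation, and both preserve Lebesgue measure. -/
theorem measurePreserving_mul_left_haar {n : ℕ} (g : Heis n) :
    MeasurePreserving (fun p => g * p) (haar n) (haar n) := by
  have hf : MeasurePreserving (fun u : HeisAlg n => g.log + shear g.log (1 / 2) u) volume volume := by
    refine (measurePreserving_add_left volume g.log).comp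
      ⟨(LinearMap.continuous_of_finiteDimensional _).measurable, ?_⟩
    rw [Real.map_linearMap_volume_pi_eq_smul_volume_pi (by simp [det_shear])]
    simp [det_shear]
  have heq : ∀ u, g * Heis.exp u = Heis.exp (g.log + shear g.log (1 / 2) u) := by
    intro u
    apply Heis.ext
    simp only [log_mul, shear_apply]
    abel
  have hm : Measurable (fun p : Heis n => g * p) := by
    refine measurable_comap_iff.2 ?_
    have : (Heis.log ∘ fun p : Heis n => g * p) =
        (fun u => g.log + shear g.log (1 / 2) u) ∘ Heis.log := by
      funext p
      exact congrArg Heis.log (heq p.log)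
    rw [this]
    exact hf.measurable.comp measurable_log
  refine ⟨hm, ?_⟩
  rw [haar, Measure.map_map hm measurable_exp]
  have : (fun p => g * p) ∘ Heis.exp = Heis.exp ∘ fun u => g.log + shear g.log (1 / 2) u :=
    funext heq
  rw [this, ← Measure.map_map measurable_exp hf.measurable, hf.map_eq]

instance measurableConstSMul_lattice {n : ℕ} (r : Fin n → ℕ) :
    MeasurableConstSMul (lattice r) (Heis n) :=
  ⟨fun γ => (measurePreserving_mul_left_haar (γ : Heis n)).measurable⟩

instance smulInvariantMeasure_lattice {n : ℕ} (r : Fin n → ℕ) (κ : ℝ≥0∞) :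
    SMulInvariantMeasure (lattice r) (Heis n) (κ • haar n) :=
  ⟨fun γ s hs => by
    rw [Measure.smul_apply, Measure.smul_apply]
    congr 1
    exact (measurePreserving_mul_left_haar (γ : Heis n)).measure_preimage hs.nullMeasurableSet⟩

open scoped Pointwise in
-- The translates of the box cover a fundamental domain F. By invariance, the pieces of F they cut
-- out have total measure equal to that of the box.
theorem totalMinPopp_le {n : ℕ} {r : Fin n → ℕ} (hr : ∀ i, 0 < r i)
    (A : Matrix (Idx n) (Idx n) ℝ) :
    totalMinPopp A r ≤ ENNReal.ofReal (minPoppDensity A) * haar n (coveringBox r) := by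
  rw [totalMinPopp, minPoppMeasure, covolume]
  split_ifs with h
  · have hF := h.ExistsIsFundamentalDomain.choose_spec
    set F := h.ExistsIsFundamentalDomain.choose
    set ν := ENNReal.ofReal (minPoppDensity A) • haar n
    calc ν F ≤ ν (⋃ γ : lattice r, γ • coveringBox r ∩ F) := by
          refine measure_mono fun p hp => ?_
          obtain ⟨γ, hγ, h⟩ := exists_mul_mem_coveringBox hr p
          refine Set.mem_iUnion.2 ⟨⟨γ, hγ⟩⁻¹, ?_, hp⟩
          rw [Set.mem_inv_smul_set_iff]
          exact h
      _ ≤ ∑' γ : lattice r, ν (γ • coveringBox r ∩ F) := measure_iUnion_le _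
      _ = ν (coveringBox r) := (hF.measure_eq_tsum _).symm
      _ = _ := rfl
  -- Without a fundamental domain, `covolume` takes its default value 0.
  · exact zero_le
/-! ### Inner products on the image -/

/-- In a two-step nilpotent group, Ad(exp g) u = u + [g, u] exactly. -/
theorem exists_of_isInnerDifferential {n : ℕ} {P : Matrix (Idx n) (Idx n) ℝ}
    (hP : IsInnerDifferential P) :
    ∃ g : HeisAlg n, ∀ u, P *ᵥ u = shear g 1 u := by
  obtain ⟨g, hg⟩ := hP
  refine ⟨g.log, fun u => ?_⟩
  have h := congrArg Heis.log (hg u)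
  rw [log_mul, log_mul, log_inv] at h
  have h1 (a b : HeisAlg n) : symp a (-b) = symp b a := by
    simp only [symp, Pi.neg_apply]
    exact Finset.sum_congr rfl fun i _ => by ring
  have h2 (a : HeisAlg n) : symp a a = 0 := by
    simp only [symp]
    exact Finset.sum_eq_zero fun i _ => by ring
  simp only [bracket, h1, symp_add_right, smul_smul, symp_smul_vecZ_right, h2] at h
  change P *ᵥ u = _ at h
  rw [h, shear_apply, bracket]
  module

theorem horizPart_shear {n : ℕ} (g : HeisAlg n) (c : ℝ) (u : HeisAlg n) :
    horizPart (shear g c u) = horizPart u := by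
  funext i
  simp [horizPart, shear_apply, bracket, vecZ, basisVec]

theorem horizPart_horizIncl {n : ℕ} (x : Horiz n) : horizPart (horizIncl x) = x := rfl

/-- The kernel of the matrix is spanned by the basis vectors it contains. -/
def HasBasisKernel {n : ℕ} (A : Matrix (Idx n) (Idx n) ℝ) : Prop :=
  ∃ I : Finset (Idx n),
    LinearMap.ker A.mulVecLin = Submodule.span ℝ (basisVec '' (I : Set (Idx n)))

/-- This is what makes the vector chosen in `imCoords` unique: kernel vectors are supported on I,
and the normalisation forces zeros there. -/
theorem HasBasisKernel.eq_zero {n : ℕ} {A : Matrix (Idx n) (Idx n) ℝ} (hA : HasBasisKernel A)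
    {ξ : Idx n → ℝ} (h0 : ∀ i, A *ᵥ basisVec i = 0 → ξ i = 0) (h : A *ᵥ ξ = 0) : ξ = 0 := by
  obtain ⟨I, hI⟩ := hA
  have hmem : ξ ∈ Submodule.span ℝ (basisVec '' (I : Set (Idx n))) := by
    rw [← hI]
    exact h
  have hle : Submodule.span ℝ (basisVec '' (I : Set (Idx n))) ≤
      LinearMap.ker (LinearMap.funLeft ℝ ℝ (Subtype.val : {i // i ∉ I} → Idx n)) := by
    rw [Submodule.span_le]
    rintro _ ⟨i, hi, rfl⟩
    rw [SetLike.mem_coe, LinearMap.mem_ker]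
    funext j
    have : (j : Idx n) ≠ i := fun h => j.2 (h ▸ hi)
    simp [LinearMap.funLeft_apply, basisVec, this]
  funext i
  by_cases hi : i ∈ I
  · refine h0 i ?_
    have : basisVec i ∈ LinearMap.ker A.mulVecLin := by
      rw [hI]
      exact Submodule.subset_span ⟨i, hi, rfl⟩
    exact this
  · exact congrFun (LinearMap.mem_ker.1 (hle hmem)) ⟨i, hi⟩

theorem HasBasisKernel.imCoords_eq {n : ℕ} {A : Matrix (Idx n) (Idx n) ℝ} (hA : HasBasisKernel A)
    {ξ : Idx n → ℝ} (h0 : ∀ i, A *ᵥ basisVec i = 0 → ξ i = 0) : imCoords A (A *ᵥ ξ) = ξ := by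
  have h : ∃ η : Idx n → ℝ, (∀ i, A *ᵥ basisVec i = 0 → η i = 0) ∧ A *ᵥ η = A *ᵥ ξ := ⟨ξ, h0, rfl⟩
  rw [imCoords, dif_pos h]
  refine sub_eq_zero.1 (hA.eq_zero (fun i hi => ?_) ?_)
  · rw [Pi.sub_apply, h.choose_spec.1 i hi, h0 i hi, sub_zero]
  · rw [Matrix.mulVec_sub, h.choose_spec.2, sub_self]

theorem mulVec_imCoords {n : ℕ} {A : Matrix (Idx n) (Idx n) ℝ}
    {u : HeisAlg n} (hu : u ∈ im A) : A *ᵥ imCoords A u = u := by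
  classical
  obtain ⟨η, rfl⟩ := hu
  have h : ∃ ξ : Idx n → ℝ, (∀ i, A *ᵥ basisVec i = 0 → ξ i = 0) ∧ A *ᵥ ξ = A *ᵥ η := by
    refine ⟨fun i => if A *ᵥ basisVec i = 0 then 0 else η i, fun i hi => by simp [hi], ?_⟩
    rw [← sub_eq_zero, ← Matrix.mulVec_sub, Matrix.mulVec_eq_sum]
    refine Finset.sum_eq_zero fun i _ => ?_
    have hcol : Aᵀ i = A *ᵥ basisVec i := by
      rw [basisVec, Matrix.mulVec_single_one]
      rfl
    by_cases hi : A *ᵥ basisVec i = 0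
    · rw [hcol, hi, smul_zero]
    · simp [hi]
  have : imCoords A (A.mulVecLin η) = h.choose := by
    rw [imCoords, Matrix.mulVecLin_apply, dif_pos h]
  rw [this]
  exact h.choose_spec.2

theorem HasBasisKernel.metricInner_mulVec {n : ℕ} {A : Matrix (Idx n) (Idx n) ℝ}
    (hA : HasBasisKernel A) {ξ η : Idx n → ℝ} (h0 : ∀ i, A *ᵥ basisVec i = 0 → ξ i = 0)
    (h1 : ∀ i, A *ᵥ basisVec i = 0 → η i = 0) :
    metricInner A (A *ᵥ ξ) (A *ᵥ η) = ξ ⬝ᵥ η := by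
  rw [metricInner, hA.imCoords_eq h0, hA.imCoords_eq h1]

/-! ### Matrices in weak canonical form -/

theorem weakCanonical_mulVec {n : ℕ} (At : Matrix (HIdx n) (HIdx n) ℝ) (ρ : ℝ) (u : HeisAlg n) :
    weakCanonical At ρ *ᵥ u =
      Sum.elim (At *ᵥ horizPart u) (fun _ => ρ * u (Sum.inr ())) := by
  have hu : u = Sum.elim (horizPart u) (fun _ => u (Sum.inr ())) := by
    funext i
    rcases i with i | i <;> rfl
  conv_lhs => rw [hu]
  rw [weakCanonical, Matrix.fromBlocks_mulVec]
  funext i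
  rcases i with i | i
  · simp
  · simp [Matrix.mulVec, dotProduct]

theorem det_weakCanonical {n : ℕ} (At : Matrix (HIdx n) (HIdx n) ℝ) (ρ : ℝ) :
    (weakCanonical At ρ).det = At.det * ρ := by
  rw [weakCanonical, Matrix.det_fromBlocks_zero₂₁]
  simp

theorem mulVec_injective_of_det_ne_zero {ι : Type*} [Fintype ι] [DecidableEq ι]
    {M : Matrix ι ι ℝ} (hM : M.det ≠ 0) : Function.Injective M.mulVec :=
  Matrix.mulVec_injective_iff_isUnit.2 ((Matrix.isUnit_iff_isUnit_det M).2 (isUnit_iff_ne_zero.2 hM))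

theorem horizPart_eq_zero_of_weakCanonical {n : ℕ} {At : Matrix (HIdx n) (HIdx n) ℝ}
    (hAt : At.det ≠ 0) {ρ : ℝ} {u : HeisAlg n} (h : weakCanonical At ρ *ᵥ u = 0) :
    horizPart u = 0 := by
  refine mulVec_injective_of_det_ne_zero hAt ?_
  rw [weakCanonical_mulVec] at h
  funext i
  rw [Matrix.mulVec_zero]
  exact congrFun h (Sum.inl i)

theorem hasBasisKernel_weakCanonical {n : ℕ} {At : Matrix (HIdx n) (HIdx n) ℝ}
    (hAt : At.det ≠ 0) (ρ : ℝ) : HasBasisKernel (weakCanonical At ρ) := by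
  by_cases hρ : ρ = 0
  · refine ⟨{Sum.inr ()}, le_antisymm (fun u hu => ?_) ?_⟩
    · have h := horizPart_eq_zero_of_weakCanonical hAt (LinearMap.mem_ker.1 hu)
      have : u = u (Sum.inr ()) • basisVec (Sum.inr ()) := by
        funext i
        rcases i with i | i
        · have hi : u (Sum.inl i) = 0 := congrFun h i
          simp [basisVec, hi]
        · simp [basisVec]
      rw [this]
      exact Submodule.smul_mem _ _ (Submodule.subset_span ⟨_, by simp, rfl⟩)
    · rw [Submodule.span_le]
      rintro _ ⟨i, hi, rfl⟩
      have hi : i = Sum.inr () := by simpa using hi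
      subst hi
      rw [SetLike.mem_coe, LinearMap.mem_ker, Matrix.mulVecLin_apply, weakCanonical_mulVec, hρ]
      have : horizPart (basisVec (Sum.inr ()) : HeisAlg n) = 0 := by
        funext i
        simp [horizPart, basisVec]
      rw [this]
      funext i
      rcases i with i | i <;> simp
  · refine ⟨∅, ?_⟩
    rw [Finset.coe_empty, Set.image_empty, Submodule.span_empty, LinearMap.ker_eq_bot]
    exact mulVec_injective_of_det_ne_zero (by rw [det_weakCanonical]; exact mul_ne_zero hAt hρ)

theorem metricInner_weakCanonical {n : ℕ} {At : Matrix (HIdx n) (HIdx n) ℝ}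
    (hAt : At.det ≠ 0) (ρ : ℝ) (x y : Horiz n) :
    metricInner (weakCanonical At ρ) (horizIncl x) (horizIncl y) =
      (At⁻¹ *ᵥ x) ⬝ᵥ (At⁻¹ *ᵥ y) := by
  have h (x : Horiz n) : horizIncl x = weakCanonical At ρ *ᵥ horizIncl (At⁻¹ *ᵥ x) := by
    rw [weakCanonical_mulVec, horizPart_horizIncl, Matrix.mulVec_mulVec,
      Matrix.mul_nonsing_inv _ (isUnit_iff_ne_zero.2 hAt), Matrix.one_mulVec]
    funext i
    rcases i with i | i <;> simp [horizIncl]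
  have h0 (x : Horiz n) (i : Idx n) (hi : weakCanonical At ρ *ᵥ basisVec i = 0) :
      horizIncl x i = 0 := by
    have := horizPart_eq_zero_of_weakCanonical hAt hi
    rcases i with i | i
    · simpa [horizPart, basisVec] using congrFun this i
    · rfl
  rw [h x, h y, (hasBasisKernel_weakCanonical hAt ρ).metricInner_mulVec (h0 _) (h0 _)]
  simp [horizIncl, dotProduct, Fintype.sum_sum_type]

/-! ### The symplectic form in an orthonormal frame -/

/-- The matrix of the symplectic form in the standard basis. -/
def sympMatrix (n : ℕ) : Matrix (HIdx n) (HIdx n) ℝ := Matrix.fromBlocks 0 1 (-1) 0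

theorem symp_eq_dotProduct {n : ℕ} (u v : HeisAlg n) :
    symp u v = horizPart u ⬝ᵥ sympMatrix n *ᵥ horizPart v := by
  have h : sympMatrix n *ᵥ horizPart v = Sum.elim (fun i => v (Sum.inl (Sum.inr i)))
      (fun i => -v (Sum.inl (Sum.inl i))) := by
    have hv : horizPart v = Sum.elim (fun i => v (Sum.inl (Sum.inl i)))
        (fun i => v (Sum.inl (Sum.inr i))) := by
      funext i
      rcases i with i | i <;> rfl
    rw [hv, sympMatrix, Matrix.fromBlocks_mulVec]
    funext i
    rcases i with i | i <;> simp [Matrix.neg_mulVec]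
  rw [h, symp]
  simp [dotProduct, Fintype.sum_sum_type, horizPart, sub_eq_add_neg, Finset.sum_add_distrib]

theorem sympMatrix_transpose (n : ℕ) : (sympMatrix n)ᵀ = -sympMatrix n := by
  simp [sympMatrix, Matrix.fromBlocks_transpose, Matrix.fromBlocks_neg]

theorem sympMatrix_mul_self (n : ℕ) : sympMatrix n * sympMatrix n = -1 := by
  rw [sympMatrix, Matrix.fromBlocks_multiply, ← Matrix.fromBlocks_one, Matrix.fromBlocks_neg]
  simp

/-- The matrix of the symplectic form in the frame formed by the columns of `At`. -/
def frameForm {n : ℕ} (At : Matrix (HIdx n) (HIdx n) ℝ) : Matrix (HIdx n) (HIdx n) ℝ :=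
  Atᵀ * sympMatrix n * At

/-- The Hilbert–Schmidt norm of the symplectic form in the frame formed by the columns of `At`. -/
noncomputable def formNorm {n : ℕ} (At : Matrix (HIdx n) (HIdx n) ℝ) : ℝ :=
  √(∑ i, ∑ j, frameForm At i j ^ 2)

theorem formNorm_nonneg {n : ℕ} (At : Matrix (HIdx n) (HIdx n) ℝ) : 0 ≤ formNorm At :=
  Real.sqrt_nonneg _

theorem formNorm_sq {n : ℕ} (At : Matrix (HIdx n) (HIdx n) ℝ) :
    formNorm At ^ 2 = ∑ i, ∑ j, frameForm At i j ^ 2 :=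
  Real.sq_sqrt (by positivity)

/-- Only horizontal parts enter ω, so central components of u and v are unrestricted. -/
theorem symp_eq_frameForm {n : ℕ} (At : Matrix (HIdx n) (HIdx n) ℝ) {u v : HeisAlg n}
    {x y : Horiz n} (hu : horizPart u = At *ᵥ x) (hv : horizPart v = At *ᵥ y) :
    symp u v = x ⬝ᵥ frameForm At *ᵥ y := by
  rw [symp_eq_dotProduct, hu, hv, frameForm, ← Matrix.mulVec_mulVec, ← Matrix.mulVec_mulVec,
    Matrix.dotProduct_mulVec x, Matrix.vecMul_transpose]

theorem formNorm_pos {n : ℕ} (hn : 0 < n) {At : Matrix (HIdx n) (HIdx n) ℝ} (hAt : At.det ≠ 0) :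
    0 < formNorm At := by
  have h0 : frameForm At ≠ 0 := by
    intro h
    have h1 : (frameForm At).det = 0 := by
      rw [h]
      have : Nonempty (HIdx n) := ⟨Sum.inl ⟨0, hn⟩⟩
      exact Matrix.det_zero
    have h2 : (sympMatrix n).det ≠ 0 := by
      intro h
      have := congrArg Matrix.det (sympMatrix_mul_self n)
      rw [Matrix.det_mul, h, zero_mul, Matrix.det_neg, Matrix.det_one, mul_one] at this
      exact pow_ne_zero _ (by norm_num) this.symm
    rw [frameForm, Matrix.det_mul, Matrix.det_mul, Matrix.det_transpose] at h1
    exact mul_ne_zero (mul_ne_zero hAt h2) hAt h1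
  refine Real.sqrt_pos.2 (lt_of_le_of_ne (by positivity) fun h => h0 ?_)
  ext i j
  rw [eq_comm, Finset.sum_eq_zero_iff_of_nonneg fun i _ => by positivity] at h
  have h1 := h i (Finset.mem_univ i)
  rw [Finset.sum_eq_zero_iff_of_nonneg fun i _ => by positivity] at h1
  exact pow_eq_zero_iff two_ne_zero |>.1 (h1 j (Finset.mem_univ j))

theorem sum_sq_mulVec_le {ι : Type*} [Fintype ι] (M : Matrix ι ι ℝ) (y : ι → ℝ) :
    ∑ i, ((M *ᵥ y) i) ^ 2 ≤ (∑ i, ∑ j, M i j ^ 2) * ∑ j, y j ^ 2 := by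
  rw [Finset.sum_mul]
  exact Finset.sum_le_sum fun i _ => Finset.sum_mul_sq_le_sq_mul_sq _ _ _

/-! ### Reduction to weak canonical form -/

/-- The matrix `A` is brought to weak canonical form by the inner differential `P` and the
orthogonal matrix `R`. -/
structure IsReduction {n : ℕ} (A P R : Matrix (Idx n) (Idx n) ℝ)
    (At : Matrix (HIdx n) (HIdx n) ℝ) (ρ : ℝ) : Prop where
  det_ne_zero : At.det ≠ 0
  shear : ∃ g : HeisAlg n, ∀ u, P *ᵥ u = shear g 1 u
  orthogonal : R ∈ Matrix.orthogonalGroup (Idx n) ℝ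
  eq : P * A * R = weakCanonical At ρ
  kernel : HasBasisKernel A

theorem minPoppDensity_le {n : ℕ} {A : Matrix (Idx n) (Idx n) ℝ} {w : Submodule ℝ (HeisAlg n)}
    {κ : ℝ} (hw : w ≤ im A) (hbg : BracketGenerating w) (hκ : IsPoppDensity A w κ) :
    minPoppDensity A ≤ κ := by
  refine csInf_le ⟨0, ?_⟩ ⟨w, hw, hbg, hκ⟩
  rintro _ ⟨_, _, _, S, b, _, rfl⟩
  positivity

namespace IsReduction

variable {n : ℕ} {A P R : Matrix (Idx n) (Idx n) ℝ} {At : Matrix (HIdx n) (HIdx n) ℝ} {ρ : ℝ}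

theorem det_inner (h : IsReduction A P R At ρ) : P.det = 1 := by
  obtain ⟨g, hg⟩ := h.shear
  have : Matrix.toLin' P = HeisenbergModuli.shear g 1 := LinearMap.ext hg
  rw [← LinearMap.det_toLin', this, det_shear]

theorem horizPart_inner (h : IsReduction A P R At ρ) (u : HeisAlg n) :
    horizPart (P *ᵥ u) = horizPart u := by
  obtain ⟨g, hg⟩ := h.shear
  rw [hg, horizPart_shear]

theorem inner_smul_vecZ (h : IsReduction A P R At ρ) (c : ℝ) :
    P *ᵥ (c • vecZ) = c • (vecZ : HeisAlg n) := by
  obtain ⟨g, hg⟩ := h.shear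
  rw [hg, shear_apply, bracket, symp_smul_vecZ_right]
  simp

theorem inner_mulVec (h : IsReduction A P R At ρ) (x : HeisAlg n) :
    P *ᵥ (A *ᵥ (R *ᵥ x)) = weakCanonical At ρ *ᵥ x := by
  rw [Matrix.mulVec_mulVec, Matrix.mulVec_mulVec, ← h.eq, mul_assoc]

theorem mul_transpose (h : IsReduction A P R At ρ) : R * Rᵀ = 1 :=
  Matrix.mem_unitaryGroup_iff.1 h.orthogonal

theorem transpose_mul (h : IsReduction A P R At ρ) : Rᵀ * R = 1 :=
  Matrix.mem_unitaryGroup_iff'.1 h.orthogonal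

theorem inner_mulVec' (h : IsReduction A P R At ρ) (x : HeisAlg n) :
    P *ᵥ (A *ᵥ x) = weakCanonical At ρ *ᵥ (Rᵀ *ᵥ x) := by
  rw [← h.inner_mulVec, Matrix.mulVec_mulVec x R, h.mul_transpose, Matrix.one_mulVec]

theorem horizPart_mulVec (h : IsReduction A P R At ρ) (x : HeisAlg n) :
    horizPart (A *ᵥ x) = At *ᵥ horizPart (Rᵀ *ᵥ x) := by
  rw [← h.horizPart_inner, h.inner_mulVec', weakCanonical_mulVec]
  rfl

theorem abs_det (h : IsReduction A P R At ρ) : |A.det| = |At.det| * |ρ| := by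
  have h1 := congrArg Matrix.det h.eq
  rw [Matrix.det_mul, Matrix.det_mul, h.det_inner, one_mul, det_weakCanonical] at h1
  have h2 : |R.det| = 1 := by
    have := congrArg Matrix.det h.mul_transpose
    rw [Matrix.det_mul, Matrix.det_transpose, Matrix.det_one] at this
    rcases mul_self_eq_one_iff.1 this with h | h <;> simp [h]
  rw [← abs_mul, ← h1, abs_mul, h2, mul_one]

/-- The projection onto the horizontal space does not increase norms. -/
theorem dotProduct_horizPart_le (h : IsReduction A P R At ρ) {u : HeisAlg n} (hu : u ∈ im A) :
    (At⁻¹ *ᵥ horizPart u) ⬝ᵥ (At⁻¹ *ᵥ horizPart u) ≤ metricInner A u u := by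
  have hξ := mulVec_imCoords hu
  set ξ := imCoords A u with hξdef
  -- In the rotated coordinates Rᵀξ, projecting to 𝔳₀ means dropping the last coordinate, and R
  -- preserves the norm.
  have h1 : At⁻¹ *ᵥ horizPart u = horizPart (Rᵀ *ᵥ ξ) := by
    rw [← hξ, h.horizPart_mulVec, Matrix.mulVec_mulVec,
      Matrix.nonsing_inv_mul _ (isUnit_iff_ne_zero.2 h.det_ne_zero), Matrix.one_mulVec]
  have h2 : metricInner A u u = (Rᵀ *ᵥ ξ) ⬝ᵥ (Rᵀ *ᵥ ξ) := by
    rw [metricInner, ← hξdef, Matrix.dotProduct_mulVec, Matrix.vecMul_transpose,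
      Matrix.mulVec_mulVec, h.mul_transpose, Matrix.one_mulVec]
  rw [h1, h2]
  simp only [dotProduct, Fintype.sum_sum_type (α₁ := HIdx n), horizPart]
  simp only [Finset.univ_unique, Finset.sum_singleton, le_add_iff_nonneg_right]
  exact mul_self_nonneg _

/-! ### Popp frames -/

/-- If A kills e_k, injectivity of `At` makes Rᵀe_k purely central, hence orthogonal to horizontal
basis vectors. So R e_i is a legitimate coordinate vector for `imCoords`, and the vectors A R e_i
are orthonormal. -/
theorem apply_eq_zero (h : IsReduction A P R At ρ) (i : HIdx n) (k : Idx n)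
    (hk : A *ᵥ basisVec k = 0) : (R *ᵥ basisVec (Sum.inl i)) k = 0 := by
  have h1 := h.horizPart_mulVec (basisVec k)
  rw [hk] at h1
  have h2 : horizPart (Rᵀ *ᵥ basisVec k) = 0 :=
    mulVec_injective_of_det_ne_zero h.det_ne_zero (by
      rw [← h1, Matrix.mulVec_zero]
      rfl)
  have h3 := congrFun h2 i
  simpa [horizPart, basisVec] using h3

theorem isPoppDensity_top (h : IsReduction A P R At ρ) (hρ : ρ ≠ 0) :
    im A = ⊤ ∧ IsPoppDensity A ⊤ (|At.det| * |ρ|)⁻¹ := by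
  have hdet : A.det ≠ 0 := by
    rw [← abs_ne_zero, h.abs_det]
    exact mul_ne_zero (abs_ne_zero.2 h.det_ne_zero) (abs_ne_zero.2 hρ)
  have hof : Matrix.of (fun i => A *ᵥ basisVec i) = Aᵀ := by
    ext i j
    simp [basisVec]
  have hli : LinearIndependent ℝ (fun i => A *ᵥ basisVec i) := by
    have : LinearIndependent ℝ (Aᵀ).row := Matrix.linearIndependent_rows_iff_isUnit.2
      ((Matrix.isUnit_iff_isUnit_det _).2 (by simpa using hdet))
    rwa [← hof] at this
  have hspan : Submodule.span ℝ (Set.range fun i => A *ᵥ basisVec i) = ⊤ :=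
    hli.span_eq_top_of_card_eq_finrank' (by simp)
  refine ⟨?_, Finset.univ, fun i => A *ᵥ basisVec i, ⟨hli, ?_, fun i _ j _ => ?_, fun t => ?_⟩, ?_⟩
  · rw [eq_top_iff, ← hspan, Submodule.span_le]
    rintro _ ⟨i, rfl⟩
    exact ⟨_, rfl⟩
  · rw [Finset.coe_univ, Set.image_univ, hspan]
  · have h0 (i k : Idx n) (hk : A *ᵥ basisVec k = 0) : (basisVec i : HeisAlg n) k = 0 := by
      have := mulVec_injective_of_det_ne_zero hdet (hk.trans (Matrix.mulVec_zero A).symm)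
      simpa [basisVec] using congrFun this k
    rw [h.kernel.metricInner_mulVec (h0 i) (h0 j)]
    simp [basisVec, Pi.single_apply, eq_comm]
  · rw [Finset.compl_univ, Finset.sum_empty, Finset.sum_empty, quotNormSq]
    refine IsLeast.csInf_eq ⟨⟨0, Submodule.mem_top, by simp⟩, ?_⟩
    rintro _ ⟨a, -, rfl⟩
    positivity
  · rw [hof, Matrix.det_transpose, h.abs_det]

/-- A frame whose first vectors are an orthonormal basis of the image of `𝔳₀` under the inverse of
the inner differential, and whose last vector is a multiple of `Z`. -/
def horizFrame (A R : Matrix (Idx n) (Idx n) ℝ) (c : ℝ) : Idx n → HeisAlg n :=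
  Sum.elim (fun i => A *ᵥ (R *ᵥ basisVec (Sum.inl i))) (fun _ => c • vecZ)

theorem inner_mul_horizFrame (h : IsReduction A P R At ρ) (c : ℝ) :
    P * (Matrix.of (horizFrame A R c))ᵀ = weakCanonical At c := by
  refine Matrix.ext_of_mulVec_single fun j => ?_
  rw [← Matrix.mulVec_mulVec]
  have h1 : (Matrix.of (horizFrame A R c))ᵀ *ᵥ Pi.single j 1 = horizFrame A R c j := by
    funext i
    simp
  rw [h1, weakCanonical_mulVec]
  rcases j with j | j
  · rw [horizFrame, Sum.elim_inl, h.inner_mulVec, weakCanonical_mulVec]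
    simp [basisVec]
  · rw [horizFrame, Sum.elim_inr, h.inner_smul_vecZ]
    have h2 : horizPart (Pi.single (Sum.inr j) 1 : HeisAlg n) = 0 := by
      funext i
      simp [horizPart]
    rw [h2]
    funext i
    rcases i with i | i <;> simp [vecZ, basisVec]

theorem det_horizFrame (h : IsReduction A P R At ρ) (c : ℝ) :
    (Matrix.of (horizFrame A R c)).det = At.det * c := by
  have := congrArg Matrix.det (h.inner_mul_horizFrame c)
  rwa [Matrix.det_mul, h.det_inner, one_mul, Matrix.det_transpose, det_weakCanonical] at this

theorem linearIndependent_horizFrame (h : IsReduction A P R At ρ) {c : ℝ} (hc : c ≠ 0) :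
    LinearIndependent ℝ (horizFrame A R c) := by
  have : LinearIndependent ℝ (Matrix.of (horizFrame A R c)).row :=
    Matrix.linearIndependent_rows_iff_isUnit.2 ((Matrix.isUnit_iff_isUnit_det _).2
      (isUnit_iff_ne_zero.2 (by
        rw [h.det_horizFrame]
        exact mul_ne_zero h.det_ne_zero hc)))
  exact this

theorem symp_horizFrame (h : IsReduction A P R At ρ) (c : ℝ) (i j : HIdx n) :
    symp (horizFrame A R c (Sum.inl i)) (horizFrame A R c (Sum.inl j)) = frameForm At i j := by
  have h1 (i : HIdx n) : horizPart (horizFrame A R c (Sum.inl i)) = At *ᵥ Pi.single i 1 := by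
    rw [horizFrame, Sum.elim_inl, h.horizPart_mulVec, Matrix.mulVec_mulVec, h.transpose_mul,
      Matrix.one_mulVec]
    congr 1
    funext j
    simp [horizPart, basisVec, Pi.single_apply]
  rw [symp_eq_frameForm At (h1 i) (h1 j)]
  simp

/-- The indices of the horizontal basis vectors. -/
def horizIndices (n : ℕ) : Finset (Idx n) := Finset.univ.map Function.Embedding.inl

theorem compl_horizIndices (n : ℕ) : (horizIndices n)ᶜ = {Sum.inr ()} := by
  ext i
  rcases i with i | i <;> simp [horizIndices]

/-- The span of the horizontal vectors of the frame. -/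
def horizSpan (A R : Matrix (Idx n) (Idx n) ℝ) : Submodule ℝ (HeisAlg n) :=
  Submodule.span ℝ (Set.range fun i : HIdx n => A *ᵥ (R *ᵥ basisVec (Sum.inl i)))

theorem smul_vecZ_mem_horizSpan_iff (h : IsReduction A P R At ρ) (c : ℝ) :
    c • vecZ ∈ horizSpan A R ↔ c = 0 := by
  refine ⟨fun hc => ?_, fun hc => by rw [hc, zero_smul]; exact zero_mem _⟩
  have hle : horizSpan A R ≤ LinearMap.ker
      ((LinearMap.proj (Sum.inr ()) : HeisAlg n →ₗ[ℝ] ℝ) ∘ₗ P.mulVecLin) := by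
    rw [horizSpan, Submodule.span_le]
    rintro _ ⟨i, rfl⟩
    rw [SetLike.mem_coe, LinearMap.mem_ker, LinearMap.comp_apply, Matrix.mulVecLin_apply,
      h.inner_mulVec, weakCanonical_mulVec]
    simp [basisVec]
  have := LinearMap.mem_ker.1 (hle hc)
  rw [LinearMap.comp_apply, Matrix.mulVecLin_apply, h.inner_smul_vecZ] at this
  simpa [vecZ, basisVec] using this

theorem bracketGenerating_horizSpan (h : IsReduction A P R At ρ) (hs : 0 < formNorm At) :
    BracketGenerating (horizSpan A R) := by
  refine ⟨1, eq_top_iff.2 ?_⟩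
  have hspan : Submodule.span ℝ (Set.range (horizFrame A R 1)) = ⊤ :=
    (h.linearIndependent_horizFrame one_ne_zero).span_eq_top_of_card_eq_finrank' (by simp)
  rw [← hspan, Submodule.span_le]
  rintro _ ⟨i | i, rfl⟩
  · exact Submodule.mem_sup_left (Submodule.subset_span ⟨i, rfl⟩)
  · obtain ⟨i, j, hij⟩ : ∃ i j, frameForm At i j ≠ 0 := by
      by_contra! hc
      simp [formNorm, hc] at hs
    have hZ : (horizFrame A R 1 (Sum.inr ())) = (frameForm At i j)⁻¹ •
        bracket (horizFrame A R 1 (Sum.inl i)) (horizFrame A R 1 (Sum.inl j)) := by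
      rw [bracket, h.symp_horizFrame, smul_smul, inv_mul_cancel₀ hij]
      rfl
    change horizFrame A R 1 (Sum.inr ()) ∈ _
    rw [hZ]
    refine Submodule.smul_mem _ _ (Submodule.mem_sup_right (Submodule.subset_span
      ⟨_, Submodule.subset_span ⟨i, rfl⟩, _, Submodule.subset_span ⟨j, rfl⟩, rfl⟩))

/-- Modulo the horizontal span, a tensor a maps to ⟨a, F⟩ Z, where F is `frameForm At`. The quotient
norm of Z is thus 1/‖F‖, and `formNorm At` • Z completes the frame. -/
theorem isPoppDensity_horizSpan (h : IsReduction A P R At ρ) (hs : 0 < formNorm At) :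
    IsPoppDensity A (horizSpan A R) (|At.det| * formNorm At)⁻¹ := by
  refine ⟨horizIndices n, horizFrame A R (formNorm At),
    ⟨h.linearIndependent_horizFrame hs.ne', ?_, ?_, fun t => ?_⟩, ?_⟩
  · rw [horizSpan]
    congr 1
    ext x
    simp [horizIndices, horizFrame]
  · intro i hi j hj
    obtain ⟨i, -, rfl⟩ := Finset.mem_map.1 hi
    obtain ⟨j, -, rfl⟩ := Finset.mem_map.1 hj
    simp only [Function.Embedding.inl_apply, horizFrame, Sum.elim_inl]
    rw [h.kernel.metricInner_mulVec (h.apply_eq_zero i) (h.apply_eq_zero j),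
      Matrix.dotProduct_mulVec, ← Matrix.mulVec_transpose, Matrix.mulVec_mulVec, h.transpose_mul,
      Matrix.one_mulVec]
    simp [basisVec, Pi.single_apply, eq_comm]
  · rw [compl_horizIndices, Finset.sum_singleton, Finset.sum_singleton, quotNormSq]
    set s := formNorm At with hsdef
    set τ := t (Sum.inr ())
    have key (a : Idx n → Idx n → ℝ) :
        (∑ i ∈ horizIndices n, ∑ j ∈ horizIndices n,
            a i j • bracket (horizFrame A R s i) (horizFrame A R s j)) -
          τ • horizFrame A R s (Sum.inr ()) ∈ horizSpan A R ↔
        ∑ i, ∑ j, a (Sum.inl i) (Sum.inl j) * frameForm At i j = τ * s := by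
      have : (∑ i ∈ horizIndices n, ∑ j ∈ horizIndices n,
            a i j • bracket (horizFrame A R s i) (horizFrame A R s j)) -
          τ • horizFrame A R s (Sum.inr ()) =
          (∑ i, ∑ j, a (Sum.inl i) (Sum.inl j) * frameForm At i j - τ * s) • vecZ := by
        simp only [horizIndices, Finset.sum_map, Function.Embedding.inl_apply, bracket,
          h.symp_horizFrame, smul_smul, ← Finset.sum_smul, sub_smul]
        rw [horizFrame, Sum.elim_inr, smul_smul]
      rw [this, h.smul_vecZ_mem_horizSpan_iff, sub_eq_zero]
    have hsum (a : Idx n → Idx n → ℝ) : ∑ i ∈ horizIndices n, ∑ j ∈ horizIndices n, a i j ^ 2 =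
        ∑ i, ∑ j, a (Sum.inl i) (Sum.inl j) ^ 2 := by
      simp [horizIndices, Finset.sum_map]
    have hsq := formNorm_sq At
    rw [← hsdef] at hsq
    -- The shortest solution of ⟨a, F⟩ = τs is parallel to F, namely (τ/s)F since ‖F‖ = s.
    -- Cauchy–Schwarz gives minimality.
    refine IsLeast.csInf_eq ⟨⟨fun i j => Sum.elim (fun i => Sum.elim
      (fun j => τ / s * frameForm At i j) 0 j) 0 i, (key _).2 ?_, ?_⟩, ?_⟩
    · simp only [Sum.elim_inl, mul_assoc, ← pow_two, ← Finset.mul_sum]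
      rw [← hsq]
      field_simp
    · rw [hsum]
      simp only [Sum.elim_inl, mul_pow, ← Finset.mul_sum]
      rw [← hsq]
      field_simp
    · rintro _ ⟨a, ha, rfl⟩
      rw [key] at ha
      rw [hsum]
      have hcs := Finset.sum_mul_sq_le_sq_mul_sq Finset.univ
        (fun p : HIdx n × HIdx n => a (Sum.inl p.1) (Sum.inl p.2))
        (fun p => frameForm At p.1 p.2)
      simp only [Fintype.sum_prod_type] at hcs
      rw [ha, ← hsq, mul_pow] at hcs
      exact le_of_mul_le_mul_right hcs (by positivity)
  · rw [h.det_horizFrame, abs_mul, abs_of_pos hs]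

theorem minPoppDensity_mul_formNorm_le (h : IsReduction A P R At ρ) (hs : 0 < formNorm At) :
    minPoppDensity A * (|At.det| * formNorm At) ≤ 1 := by
  have hd : 0 < |At.det| := abs_pos.2 h.det_ne_zero
  rw [← le_div_iff₀ (by positivity), one_div]
  refine minPoppDensity_le ?_ (h.bracketGenerating_horizSpan hs) (h.isPoppDensity_horizSpan hs)
  rw [horizSpan, Submodule.span_le]
  rintro _ ⟨i, rfl⟩
  exact ⟨_, rfl⟩

theorem minPoppDensity_mul_abs_le (h : IsReduction A P R At ρ) :
    minPoppDensity A * (|At.det| * |ρ|) ≤ 1 := by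
  by_cases hρ : ρ = 0
  · simp [hρ]
  have hd : 0 < |At.det| := abs_pos.2 h.det_ne_zero
  have hr : 0 < |ρ| := abs_pos.2 hρ
  rw [← le_div_iff₀ (by positivity), one_div]
  obtain ⟨h1, h2⟩ := h.isPoppDensity_top hρ
  exact minPoppDensity_le h1.ge ⟨0, rfl⟩ h2

end IsReduction

/-! ### Lengths of curves and the diameter -/

theorem _root_.AbsolutelyContinuousOnInterval.continuousLinearMap_comp
    {E F : Type*} [NormedAddCommGroup E] [NormedSpace ℝ E] [NormedAddCommGroup F] [NormedSpace ℝ F]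
    {f : ℝ → E} {a b : ℝ} (hf : AbsolutelyContinuousOnInterval f a b) (φ : E →L[ℝ] F) :
    AbsolutelyContinuousOnInterval (fun t => φ (f t)) a b := by
  rw [AbsolutelyContinuousOnInterval] at hf ⊢
  have h := hf.const_mul ‖φ‖
  rw [mul_zero] at h
  refine squeeze_zero (fun E => Finset.sum_nonneg fun i _ => dist_nonneg) (fun E => ?_) h
  rw [Finset.mul_sum]
  exact Finset.sum_le_sum fun i _ => φ.lipschitz.dist_le_mul _ _

/-- The Euclidean norm of the coordinates of `x` in the frame formed by the columns of `At`. -/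
noncomputable def frameNorm {n : ℕ} (At : Matrix (HIdx n) (HIdx n) ℝ) (x : Horiz n) : ℝ :=
  √((At⁻¹ *ᵥ x) ⬝ᵥ (At⁻¹ *ᵥ x))

theorem dotProduct_self_nonneg' {ι : Type*} [Fintype ι] (x : ι → ℝ) : 0 ≤ x ⬝ᵥ x :=
  Finset.sum_nonneg fun _ _ => mul_self_nonneg _

theorem abs_dotProduct_le {ι : Type*} [Fintype ι] (x y : ι → ℝ) :
    |x ⬝ᵥ y| ≤ √(x ⬝ᵥ x) * √(y ⬝ᵥ y) := by
  rw [← Real.sqrt_mul (dotProduct_self_nonneg' x)]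
  refine Real.abs_le_sqrt ?_
  simpa only [dotProduct, pow_two] using Finset.sum_mul_sq_le_sq_mul_sq Finset.univ x y

namespace IsReduction

variable {n : ℕ} {A P R : Matrix (Idx n) (Idx n) ℝ} {At : Matrix (HIdx n) (HIdx n) ℝ} {ρ : ℝ}

theorem frameNorm_le_metricNorm (h : IsReduction A P R At ρ) {u : HeisAlg n} (hu : u ∈ im A) :
    frameNorm At (horizPart u) ≤ metricNorm A u :=
  Real.sqrt_le_sqrt (h.dotProduct_horizPart_le hu)

/-- Calibration: pair the curve with its own horizontal displacement δ. The pairing grows by N² in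
total, at a rate of at most N times the speed, so N can be cancelled. -/
theorem frameNorm_sub_le_length (h : IsReduction A P R At ρ) {c u : ℝ → HeisAlg n}
    (hc : IsAdmissible A c u) :
    ENNReal.ofReal (frameNorm At (horizPart (c 1) - horizPart (c 0))) ≤ length A u := by
  set δ : Horiz n := At⁻¹ *ᵥ (horizPart (c 1) - horizPart (c 0)) with hδ
  set N := frameNorm At (horizPart (c 1) - horizPart (c 0)) with hN
  have hN0 : 0 ≤ N := Real.sqrt_nonneg _
  rcases hN0.eq_or_lt with h0 | hpos
  · rw [← h0]
    simp
  let φl : HeisAlg n →ₗ[ℝ] ℝ :=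
    { toFun := fun x => δ ⬝ᵥ (At⁻¹ *ᵥ horizPart x)
      map_add' := fun x y => by
        rw [← dotProduct_add, ← Matrix.mulVec_add]
        rfl
      map_smul' := fun a x => by
        have : horizPart (a • x) = a • horizPart x := rfl
        rw [this, Matrix.mulVec_smul, dotProduct_smul, RingHom.id_apply] }
  let φ : HeisAlg n →L[ℝ] ℝ := LinearMap.toContinuousLinearMap φl
  have hφ (x : HeisAlg n) : φ x = δ ⬝ᵥ (At⁻¹ *ᵥ horizPart x) := rfl
  have hend : φ (c 1) - φ (c 0) = N ^ 2 := by
    rw [hφ, hφ, ← dotProduct_sub, ← Matrix.mulVec_sub, ← hδ, hN, frameNorm,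
      Real.sq_sqrt (dotProduct_self_nonneg' _)]
  have hint := (hc.absCont.continuousLinearMap_comp φ).integral_deriv_eq_sub
  rw [hend, intervalIntegral.integral_of_le zero_le_one, ← integral_Icc_eq_integral_Ioc] at hint
  have hle : ENNReal.ofReal (N ^ 2) ≤ ENNReal.ofReal N * length A u := by
    have h1 : ENNReal.ofReal (N ^ 2) = ‖∫ t in Set.Icc (0 : ℝ) 1, deriv (fun t => φ (c t)) t‖ₑ := by
      rw [hint, Real.enorm_eq_ofReal (by positivity)]
    rw [h1, length, ← lintegral_const_mul' _ _ ENNReal.ofReal_ne_top]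
    refine (enorm_integral_le_lintegral_enorm _).trans (lintegral_mono_ae ?_)
    filter_upwards [hc.velocity] with t ht
    have hd : deriv (fun t => φ (c t)) t = φ (leftTranslate (c t) (u t)) :=
      (φ.hasFDerivAt.comp_hasDerivAt t ht.1).deriv
    have hh : horizPart (leftTranslate (c t) (u t)) = horizPart (u t) :=
      horizPart_shear (c t) (1 / 2) (u t)
    rw [hd, hφ, hh, ← ENNReal.ofReal_mul hN0, ← ofReal_norm, Real.norm_eq_abs]
    refine ENNReal.ofReal_le_ofReal ((abs_dotProduct_le _ _).trans ?_)
    exact mul_le_mul_of_nonneg_left (h.frameNorm_le_metricNorm ht.2) (Real.sqrt_nonneg _)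
  rw [pow_two, ENNReal.ofReal_mul hN0] at hle
  exact (ENNReal.mul_le_mul_iff_right (ENNReal.ofReal_pos.2 hpos).ne' ENNReal.ofReal_ne_top).1 hle

theorem exists_frameNorm_sub_lt (h : IsReduction A P R At ρ) {r : Fin n → ℕ} {D D' : ℝ}
    (hD' : 0 < D') (hDD' : D < D') (hD : diameter A r ≤ ENNReal.ofReal D) (x : Horiz n) :
    ∃ l ∈ projLattice r, frameNorm At (x - l) < D' := by
  -- The strict inequality D < D' allows an actual curve to be extracted from the infima.
  have hlt : quotDist A r (Quotient.mk _ 1) (Quotient.mk _ (Heis.exp (horizIncl x))) <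
      ENNReal.ofReal D' :=
    (le_iSup₂_of_le _ _ le_rfl).trans_lt (hD.trans_lt ((ENNReal.ofReal_lt_ofReal_iff hD').2 hDD'))
  simp only [quotDist, subRiemDist, iInf_lt_iff] at hlt
  obtain ⟨p, q, hp, hq, c, u, hc, hc0, hc1, hlen⟩ := hlt
  have hp := QuotientGroup.rightRel_apply.1 (Quotient.exact hp)
  have hq := QuotientGroup.rightRel_apply.1 (Quotient.exact hq)
  refine ⟨horizPart ((Heis.exp (horizIncl x) * q⁻¹) * (1 * p⁻¹)⁻¹).log,
    ⟨_, mul_mem hq (inv_mem hp), rfl⟩, ?_⟩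
  have heq : x - horizPart ((Heis.exp (horizIncl x) * q⁻¹) * (1 * p⁻¹)⁻¹).log =
      horizPart (c 1) - horizPart (c 0) := by
    simp only [horizPart_log_mul, one_mul, inv_inv, horizPart_log_inv, horizPart_horizIncl, hc0, hc1]
    abel
  rw [heq]
  exact (ENNReal.ofReal_lt_ofReal_iff hD').1 ((h.frameNorm_sub_le_length hc).trans_lt hlen)

end IsReduction

/-! ### Lattice vectors of bounded norm -/

/-- Go distance 2D in the direction a and take a lattice point within D: its norm is at most 3D and
its component along a is still positive. -/
theorem exists_mem_projLattice_dotProduct_ne_zero {n : ℕ} {r : Fin n → ℕ}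
    {At : Matrix (HIdx n) (HIdx n) ℝ} (hAt : At.det ≠ 0) {D : ℝ} (hD : 0 < D)
    (hcov : ∀ x : Horiz n, ∃ l ∈ projLattice r, frameNorm At (x - l) < D) {a : Horiz n}
    (ha : a ≠ 0) :
    ∃ l ∈ projLattice r, frameNorm At l ≤ 3 * D ∧ a ⬝ᵥ (At⁻¹ *ᵥ l) ≠ 0 := by
  have hinv (x : Horiz n) : At⁻¹ *ᵥ (At *ᵥ x) = x := by
    rw [Matrix.mulVec_mulVec, Matrix.nonsing_inv_mul _ (isUnit_iff_ne_zero.2 hAt),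
      Matrix.one_mulVec]
  set N := √(a ⬝ᵥ a) with hN
  have hsq : N ^ 2 = a ⬝ᵥ a := Real.sq_sqrt (dotProduct_self_nonneg' a)
  have hNpos : 0 < N := by
    refine Real.sqrt_pos.2 (lt_of_le_of_ne (dotProduct_self_nonneg' a) fun h => ha ?_)
    exact dotProduct_self_eq_zero.1 h.symm
  obtain ⟨l, hl, hlt⟩ := hcov (At *ᵥ ((2 * D / N) • a))
  set b := At⁻¹ *ᵥ l with hb
  set e := (2 * D / N) • a - b with he
  have hlt' : √(e ⬝ᵥ e) < D := by
    rwa [frameNorm, Matrix.mulVec_sub, hinv] at hlt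
  have hee : e ⬝ᵥ e < D ^ 2 := (Real.sqrt_lt' hD).1 hlt'
  have hbe : b = (2 * D / N) • a - e := by rw [he]; abel
  have hae := abs_dotProduct_le a e
  rw [← hN] at hae
  have hae' : |a ⬝ᵥ e| < N * D := hae.trans_lt (mul_lt_mul_of_pos_left hlt' hNpos)
  have hae2 := abs_lt.1 hae'
  refine ⟨l, hl, ?_, ?_⟩
  · rw [frameNorm, ← hb, Real.sqrt_le_left (by positivity), hbe]
    have : ((2 * D / N) • a - e) ⬝ᵥ ((2 * D / N) • a - e) =
        4 * D ^ 2 - 4 * D / N * (a ⬝ᵥ e) + e ⬝ᵥ e := by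
      simp only [sub_dotProduct, dotProduct_sub, smul_dotProduct, dotProduct_smul, smul_eq_mul,
        ← hsq, dotProduct_comm e a]
      field_simp
      ring
    rw [this]
    have h4 : -(4 * D / N * (a ⬝ᵥ e)) ≤ 4 * D / N * (N * D) := by
      rw [← mul_neg]
      exact mul_le_mul_of_nonneg_left (by linarith) (by positivity)
    have h5 : 4 * D / N * (N * D) = 4 * D ^ 2 := by field_simp
    nlinarith
  · rw [← hb, hbe, dotProduct_sub, dotProduct_smul, ← hsq, smul_eq_mul]
    have h6 : 2 * D / N * N ^ 2 = 2 * (N * D) := by field_simp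
    rw [h6]
    have := mul_pos hNpos hD
    exact (by linarith : (0 : ℝ) < 2 * (N * D) - a ⬝ᵥ e).ne'

theorem abs_apply_le_frameNorm {n : ℕ} (At : Matrix (HIdx n) (HIdx n) ℝ) (x : Horiz n)
    (i : HIdx n) : |(At⁻¹ *ᵥ x) i| ≤ frameNorm At x := by
  refine Real.abs_le_sqrt ?_
  rw [pow_two]
  exact Finset.single_le_sum (f := fun i => (At⁻¹ *ᵥ x) i * (At⁻¹ *ᵥ x) i)
    (fun _ _ => mul_self_nonneg _) (Finset.mem_univ i)

/-- The determinant of the frame is bounded below if the lattice vectors are sufficiently dense. -/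
theorem one_le_abs_det_mul {n : ℕ} {r : Fin n → ℕ}
    {At : Matrix (HIdx n) (HIdx n) ℝ} (hAt : At.det ≠ 0) {D : ℝ} (hD : 0 < D)
    (hcov : ∀ x : Horiz n, ∃ l ∈ projLattice r, frameNorm At (x - l) < D) :
    1 ≤ |At.det| * ((Fintype.card (HIdx n)).factorial • (3 * D) ^ Fintype.card (HIdx n)) := by
  set T : Set (Horiz n) := {y | ∃ l ∈ projLattice r, frameNorm At l ≤ 3 * D ∧ y = At⁻¹ *ᵥ l}
    with hT
  have hspan : Submodule.span ℝ T = ⊤ := by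
    by_contra hne
    obtain ⟨f, hf0, hf⟩ := Submodule.exists_le_ker_of_lt_top _ (lt_top_iff_ne_top.2 hne)
    set a : Horiz n := fun i => f (Pi.single i 1) with ha
    have hfa (y : Horiz n) : f y = a ⬝ᵥ y := by
      conv_lhs => rw [pi_eq_sum_univ' y, map_sum]
      refine Finset.sum_congr rfl fun i _ => ?_
      rw [map_smul, smul_eq_mul, mul_comm]
    have ha0 : a ≠ 0 := fun h0 => hf0 (LinearMap.ext fun y => by rw [hfa, h0]; simp)
    obtain ⟨l, hl, hln, hne⟩ := exists_mem_projLattice_dotProduct_ne_zero hAt hD hcov ha0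
    refine hne ?_
    rw [← hfa]
    exact hf (Submodule.subset_span ⟨l, hl, hln, rfl⟩)
  -- Extract a basis of short lattice vectors. Its determinant is a nonzero integer and factors as
  -- det `At` times the determinant of the frame coordinates.
  obtain ⟨b, hbT, hbspan, hbli⟩ := exists_linearIndependent ℝ T
  let B : Module.Basis b ℝ (Horiz n) := Module.Basis.mk hbli (by
    rw [Subtype.range_coe, hbspan, hspan])
  let e : b ≃ HIdx n := B.indexEquiv (Pi.basisFun ℝ (HIdx n))
  choose l hl hln hlb using fun i : HIdx n => hbT (e.symm i).2
  choose k hk using fun i => exists_int_of_mem_projLattice (hl i)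
  have hWdet : (Matrix.of fun i => At⁻¹ *ᵥ l i).det ≠ 0 := by
    have hli : LinearIndependent ℝ (fun i => At⁻¹ *ᵥ l i) := by
      have heq : (fun i => At⁻¹ *ᵥ l i) = Subtype.val ∘ e.symm := funext fun i => (hlb i).symm
      rw [heq]
      exact hbli.comp e.symm e.symm.injective
    have : LinearIndependent ℝ (Matrix.of fun i => At⁻¹ *ᵥ l i).row := hli
    exact isUnit_iff_ne_zero.1 ((Matrix.isUnit_iff_isUnit_det _).1
      (Matrix.linearIndependent_rows_iff_isUnit.1 this))
  have hLW : (Matrix.of l).det = (Matrix.of fun i => At⁻¹ *ᵥ l i).det * At.det := by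
    rw [← Matrix.det_transpose At, ← Matrix.det_mul]
    congr 1
    ext i j
    have : At *ᵥ (At⁻¹ *ᵥ l i) = l i := by
      rw [Matrix.mulVec_mulVec, Matrix.mul_nonsing_inv _ (isUnit_iff_ne_zero.2 hAt),
        Matrix.one_mulVec]
    rw [Matrix.of_apply, ← this]
    simp only [Matrix.mul_apply, Matrix.mulVec, dotProduct, Matrix.of_apply, Matrix.transpose_apply]
    exact Finset.sum_congr rfl fun m _ => mul_comm _ _
  have hint : (Matrix.of l).det = ((Matrix.of k).det : ℤ) := by
    rw [Int.cast_det]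
    congr 1
    ext i j
    simp [hk]
  have hge : 1 ≤ |(Matrix.of l).det| := by
    have hne : (Matrix.of l).det ≠ 0 := by
      rw [hLW]
      exact mul_ne_zero hWdet hAt
    rw [hint] at hne ⊢
    exact_mod_cast Int.one_le_abs (by exact_mod_cast hne)
  rw [hLW, abs_mul, mul_comm] at hge
  refine hge.trans (mul_le_mul_of_nonneg_left ?_ (abs_nonneg _))
  -- Leibniz expansion: N! terms, each a product of N entries of size at most 3D, where N = 2n.
  refine Matrix.det_le (abv := IsAbsoluteValue.toAbsoluteValue (abs : ℝ → ℝ)) fun i j => ?_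
  exact (abs_apply_le_frameNorm At (l i) j).trans (hln i)

/-! ### Systole -/

theorem abs_symp_le {n : ℕ} {At : Matrix (HIdx n) (HIdx n) ℝ} (hAt : At.det ≠ 0) (x y : Horiz n) :
    |symp (horizIncl x) (horizIncl y)| ≤ formNorm At * frameNorm At x * frameNorm At y := by
  have h (x : Horiz n) : horizPart (horizIncl x) = At *ᵥ (At⁻¹ *ᵥ x) := by
    rw [Matrix.mulVec_mulVec, Matrix.mul_nonsing_inv _ (isUnit_iff_ne_zero.2 hAt),
      Matrix.one_mulVec]
    rfl
  rw [symp_eq_frameForm At (h x) (h y), mul_comm (formNorm At), mul_assoc]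
  refine (abs_dotProduct_le _ _).trans (mul_le_mul_of_nonneg_left ?_ (Real.sqrt_nonneg _))
  rw [formNorm, frameNorm, ← Real.sqrt_mul (by positivity)]
  refine Real.sqrt_le_sqrt ?_
  simpa only [dotProduct, pow_two] using sum_sq_mulVec_le (frameForm At) (At⁻¹ *ᵥ y)

theorem one_le_formNorm_mul {n : ℕ} {r : Fin n → ℕ}
    {At : Matrix (HIdx n) (HIdx n) ℝ} (hAt : At.det ≠ 0) {D : ℝ} (hD : 0 < D)
    (hcov : ∀ x : Horiz n, ∃ l ∈ projLattice r, frameNorm At (x - l) < D) {x : Horiz n}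
    (hx : x ∈ projLattice r) (hx0 : x ≠ 0) :
    1 ≤ formNorm At * frameNorm At x * (3 * D) := by
  have hsymp (y : Horiz n) : symp (horizIncl x) (horizIncl y) =
      ((sympMatrix n * At)ᵀ *ᵥ x) ⬝ᵥ (At⁻¹ *ᵥ y) := by
    rw [symp_eq_dotProduct, Matrix.dotProduct_mulVec, Matrix.dotProduct_mulVec,
      Matrix.mulVec_transpose, Matrix.vecMul_vecMul, Matrix.mul_assoc,
      Matrix.mul_nonsing_inv _ (isUnit_iff_ne_zero.2 hAt), Matrix.mul_one,
      ← Matrix.dotProduct_mulVec, ← Matrix.dotProduct_mulVec]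
    rfl
  -- Nondegeneracy of ω, through J² = -1 for its matrix J.
  have ha : (sympMatrix n * At)ᵀ *ᵥ x ≠ 0 := by
    intro h0
    have h1 : At⁻¹ᵀ *ᵥ ((sympMatrix n * At)ᵀ *ᵥ x) = -(sympMatrix n *ᵥ x) := by
      rw [Matrix.mulVec_mulVec, ← Matrix.transpose_mul, Matrix.mul_assoc,
        Matrix.mul_nonsing_inv _ (isUnit_iff_ne_zero.2 hAt), Matrix.mul_one, sympMatrix_transpose,
        Matrix.neg_mulVec]
    have h2 : sympMatrix n *ᵥ (sympMatrix n *ᵥ x) = -x := by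
      rw [Matrix.mulVec_mulVec, sympMatrix_mul_self, Matrix.neg_mulVec, Matrix.one_mulVec]
    rw [h0, Matrix.mulVec_zero, eq_comm, neg_eq_zero] at h1
    rw [h1, Matrix.mulVec_zero, eq_comm, neg_eq_zero] at h2
    exact hx0 h2
  obtain ⟨l, hl, hln, hne⟩ := exists_mem_projLattice_dotProduct_ne_zero hAt hD hcov ha
  rw [← hsymp] at hne
  obtain ⟨k, hk⟩ := exists_int_of_mem_projLattice hx
  obtain ⟨m, hm⟩ := exists_int_of_mem_projLattice hl
  have hint : symp (horizIncl x) (horizIncl l) = ((∑ i : Fin n, (k (Sum.inl i) * m (Sum.inr i)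
      - k (Sum.inr i) * m (Sum.inl i)) : ℤ) : ℝ) := by
    simp [symp, horizIncl, hk, hm]
  have hge : 1 ≤ |symp (horizIncl x) (horizIncl l)| := by
    rw [hint] at hne ⊢
    exact_mod_cast Int.one_le_abs (by exact_mod_cast hne)
  refine hge.trans ((abs_symp_le hAt x l).trans (mul_le_mul_of_nonneg_left hln ?_))
  exact mul_nonneg (formNorm_nonneg At) (Real.sqrt_nonneg _)

theorem metricNorm_weakCanonical {n : ℕ} {At : Matrix (HIdx n) (HIdx n) ℝ}
    (hAt : At.det ≠ 0) (ρ : ℝ) (x : Horiz n) :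
    metricNorm (weakCanonical At ρ) (horizIncl x) = frameNorm At x := by
  rw [metricNorm, metricInner_weakCanonical hAt, frameNorm]

/-- A bound in the frame norm bounds the standard coordinates, which are integers. This is why the
systole is attained. -/
theorem finite_projLattice_frameNorm_le {n : ℕ} (r : Fin n → ℕ)
    {At : Matrix (HIdx n) (HIdx n) ℝ} (hAt : At.det ≠ 0) (c : ℝ) :
    {x ∈ projLattice r | frameNorm At x ≤ c}.Finite := by
  set M : ℝ := ∑ i, ∑ j, |At i j| * c with hM
  have hb : ∀ x : Horiz n, frameNorm At x ≤ c → ∀ i, |x i| ≤ M := by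
    intro x hx i
    have hc : 0 ≤ c := (Real.sqrt_nonneg _).trans hx
    have hxe : x = At *ᵥ (At⁻¹ *ᵥ x) := by
      rw [Matrix.mulVec_mulVec, Matrix.mul_nonsing_inv _ (isUnit_iff_ne_zero.2 hAt),
        Matrix.one_mulVec]
    calc |x i| = |∑ j, At i j * (At⁻¹ *ᵥ x) j| := congrArg abs (congrFun hxe i)
      _ ≤ ∑ j, |At i j * (At⁻¹ *ᵥ x) j| := Finset.abs_sum_le_sum_abs _ _
      _ ≤ ∑ j, |At i j| * c := Finset.sum_le_sum fun j _ => by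
          rw [abs_mul]
          exact mul_le_mul_of_nonneg_left ((abs_apply_le_frameNorm At x j).trans hx) (abs_nonneg _)
      _ ≤ M := Finset.single_le_sum (f := fun i => ∑ j, |At i j| * c)
          (fun i _ => Finset.sum_nonneg fun j _ => by positivity) (Finset.mem_univ i)
  refine ((Set.finite_Icc (fun _ : HIdx n => -⌈M⌉) (fun _ => ⌈M⌉)).image
    (fun k i => (k i : ℝ))).subset ?_
  rintro x ⟨hx, hxc⟩
  obtain ⟨k, hk⟩ := exists_int_of_mem_projLattice hx
  have hk' (i : HIdx n) : |k i| ≤ ⌈M⌉ := by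
    have h1 := hb x hxc i
    rw [hk] at h1
    exact_mod_cast h1.trans (Int.le_ceil M)
  exact ⟨k, ⟨fun i => (abs_le.1 (hk' i)).1, fun i => (abs_le.1 (hk' i)).2⟩,
    funext fun i => (hk i).symm⟩

theorem exists_isLeast_frameNorm {n : ℕ} (hn : 0 < n) (r : Fin n → ℕ)
    {At : Matrix (HIdx n) (HIdx n) ℝ} (hAt : At.det ≠ 0) :
    ∃ x ∈ projLattice r, x ≠ 0 ∧ ∀ y ∈ projLattice r, y ≠ 0 → frameNorm At x ≤ frameNorm At y := by
  set z : Horiz n := Pi.single (Sum.inr ⟨0, hn⟩) 1 with hz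
  have hzL : z ∈ projLattice r := by
    simpa using single_mem_projLattice r (Sum.inr ⟨0, hn⟩)
  have hz0 : z ≠ 0 := by simp [hz]
  obtain ⟨x, ⟨⟨hx, hxz⟩, hx0⟩, hmin⟩ := Set.exists_min_image
    ({x ∈ projLattice r | frameNorm At x ≤ frameNorm At z} ∩ {x | x ≠ 0}) (frameNorm At)
    ((finite_projLattice_frameNorm_le r hAt _).inter_of_left _) ⟨z, ⟨hzL, le_rfl⟩, hz0⟩
  refine ⟨x, hx, hx0, fun y hy hy0 => ?_⟩
  rcases le_total (frameNorm At y) (frameNorm At z) with h | h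
  · exact hmin y ⟨⟨hy, h⟩, hy0⟩
  · exact hxz.trans h

/-! ### The `j`-operator -/

/-- The matrix of the `j`-operator of a metric in weak canonical form. -/
def jMatrix {n : ℕ} (At : Matrix (HIdx n) (HIdx n) ℝ) : Matrix (HIdx n) (HIdx n) ℝ :=
  At * Atᵀ * (sympMatrix n)ᵀ

theorem isJOperator_jMatrix {n : ℕ} {At : Matrix (HIdx n) (HIdx n) ℝ} (hAt : At.det ≠ 0) (ρ : ℝ) :
    IsJOperator (weakCanonical At ρ) (jMatrix At) := by
  intro U V
  have hu : IsUnit At.det := isUnit_iff_ne_zero.2 hAt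
  rw [metricInner_weakCanonical hAt, symp_eq_dotProduct, horizPart_horizIncl, horizPart_horizIncl,
    jMatrix, Matrix.mulVec_mulVec, Matrix.mul_assoc, Matrix.nonsing_inv_mul_cancel_left _ _ hu,
    Matrix.dotProduct_mulVec, ← Matrix.mulVec_transpose, Matrix.mulVec_mulVec, ← Matrix.mul_assoc,
    ← Matrix.transpose_mul, Matrix.mul_nonsing_inv _ hu, Matrix.transpose_one, Matrix.one_mul,
    Matrix.mulVec_transpose, ← Matrix.dotProduct_mulVec]

theorem frameForm_transpose {n : ℕ} (At : Matrix (HIdx n) (HIdx n) ℝ) :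
    (frameForm At)ᵀ = -frameForm At := by
  simp [frameForm, Matrix.transpose_mul, sympMatrix_transpose, Matrix.mul_assoc]

/-- For invertible `At`, this conjugates j to a real skew-symmetric matrix. -/
theorem jMatrix_mul {n : ℕ} (At : Matrix (HIdx n) (HIdx n) ℝ) :
    jMatrix At * At = At * (frameForm At)ᵀ := by
  simp [jMatrix, frameForm, Matrix.transpose_mul, Matrix.mul_assoc]

theorem map_ofReal_mulVec_injective {ι : Type*} [Fintype ι] [DecidableEq ι] {M : Matrix ι ι ℝ}
    (hM : M.det ≠ 0) : Function.Injective (M.map (fun y : ℝ => (y : ℂ))).mulVec := by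
  refine Matrix.mulVec_injective_iff_isUnit.2 ((Matrix.isUnit_iff_isUnit_det _).2 ?_)
  have : (M.map (fun y : ℝ => (y : ℂ))).det = (M.det : ℂ) := (RingHom.map_det Complex.ofRealHom M).symm
  rw [this]
  exact isUnit_iff_ne_zero.2 (Complex.ofReal_ne_zero.2 hM)

theorem map_ofReal_mul {ι : Type*} [Fintype ι] (M N : Matrix ι ι ℝ) :
    (M * N).map (fun y : ℝ => (y : ℂ)) =
      M.map (fun y : ℝ => (y : ℂ)) * N.map (fun y : ℝ => (y : ℂ)) :=
  Matrix.map_mul (f := Complex.ofRealHom)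

/-- The eigenvalues of `j` are those of the symplectic form in the frame. -/
theorem hasEigenvalue_jMatrix_iff {n : ℕ} {At : Matrix (HIdx n) (HIdx n) ℝ} (hAt : At.det ≠ 0)
    (z : ℂ) :
    Module.End.HasEigenvalue (Matrix.toLin' ((jMatrix At).map (fun y : ℝ => (y : ℂ)))) z ↔
      ∃ w : HIdx n → ℂ, w ≠ 0 ∧ (frameForm At)ᵀ.map (fun y : ℝ => (y : ℂ)) *ᵥ w = z • w := by
  set Ac := At.map (fun y : ℝ => (y : ℂ)) with hAc
  have hinj := map_ofReal_mulVec_injective hAt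
  have hcomm : (jMatrix At).map (fun y : ℝ => (y : ℂ)) * Ac =
      Ac * (frameForm At)ᵀ.map (fun y : ℝ => (y : ℂ)) := by
    rw [hAc, ← map_ofReal_mul, ← map_ofReal_mul, jMatrix_mul]
  constructor
  · intro h
    obtain ⟨v, hv⟩ := h.exists_hasEigenvector
    obtain ⟨hv1, hv0⟩ := Module.End.hasEigenvector_iff.1 hv
    rw [Module.End.mem_eigenspace_iff, Matrix.toLin'_apply] at hv1
    have hsurj : Function.Surjective Ac.mulVec :=
      (LinearMap.injective_iff_surjective (f := Ac.mulVecLin)).1 hinj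
    obtain ⟨w, rfl⟩ := hsurj v
    refine ⟨w, fun h0 => hv0 (by rw [h0, Matrix.mulVec_zero]), hinj ?_⟩
    rw [← hAc, Matrix.mulVec_mulVec, ← hcomm, ← Matrix.mulVec_mulVec, hv1, Matrix.mulVec_smul]
  · rintro ⟨w, hw0, hw⟩
    refine Module.End.hasEigenvalue_of_hasEigenvector (x := Ac *ᵥ w)
      (Module.End.hasEigenvector_iff.2 ⟨?_, fun h0 => hw0 (hinj ?_)⟩)
    · rw [Module.End.mem_eigenspace_iff, Matrix.toLin'_apply, Matrix.mulVec_mulVec, hcomm,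
        ← Matrix.mulVec_mulVec, hw, Matrix.mulVec_smul]
    · rw [← hAc, h0, Matrix.mulVec_zero]

theorem norm_eigenvalue_le_formNorm {n : ℕ} {At : Matrix (HIdx n) (HIdx n) ℝ} {z : ℂ}
    {w : HIdx n → ℂ} (hw0 : w ≠ 0)
    (hw : (frameForm At)ᵀ.map (fun y : ℝ => (y : ℂ)) *ᵥ w = z • w) : ‖z‖ ≤ formNorm At := by
  have hS : 0 < ∑ j, ‖w j‖ ^ 2 := by
    obtain ⟨j, hj⟩ := Function.ne_iff.1 hw0
    exact Finset.sum_pos' (fun _ _ => by positivity)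
      ⟨j, Finset.mem_univ j, pow_pos (norm_pos_iff.2 hj) 2⟩
  have h1 : ‖z‖ ^ 2 * ∑ j, ‖w j‖ ^ 2 ≤ formNorm At ^ 2 * ∑ j, ‖w j‖ ^ 2 := by
    rw [Finset.mul_sum, formNorm_sq, Finset.sum_comm, Finset.sum_mul]
    refine Finset.sum_le_sum fun i _ => ?_
    rw [← mul_pow, ← norm_mul]
    have hi : z * w i = ∑ j, (frameForm At j i : ℂ) * w j := by
      have := congrFun hw i
      rw [Pi.smul_apply, smul_eq_mul] at this
      rw [← this]
      rfl
    rw [hi]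
    calc ‖∑ j, (frameForm At j i : ℂ) * w j‖ ^ 2
        ≤ (∑ j, |frameForm At j i| * ‖w j‖) ^ 2 := by
          gcongr
          refine (norm_sum_le _ _).trans (le_of_eq (Finset.sum_congr rfl fun j _ => ?_))
          rw [norm_mul, Complex.norm_real, Real.norm_eq_abs]
      _ ≤ (∑ j, |frameForm At j i| ^ 2) * ∑ j, ‖w j‖ ^ 2 :=
          Finset.sum_mul_sq_le_sq_mul_sq _ _ _
      _ = _ := by simp only [sq_abs]
  exact abs_le_of_sq_le_sq' (le_of_mul_le_mul_right h1 hS) (formNorm_nonneg At) |>.2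

theorem exists_isTopFrequency {n : ℕ} (hn : 0 < n) {At : Matrix (HIdx n) (HIdx n) ℝ}
    (hAt : At.det ≠ 0) : ∃ d, IsTopFrequency (jMatrix At) d ∧ d ≤ formNorm At := by
  set E := {x : ℝ | Module.End.HasEigenvalue
    (Matrix.toLin' ((jMatrix At).map (fun y : ℝ => (y : ℂ)))) ((x : ℂ) * Complex.I)} with hE
  have hfin : E.Finite := by
    have h := Module.End.finite_hasEigenvalue
      (Matrix.toLin' ((jMatrix At).map (fun y : ℝ => (y : ℂ))))
    refine h.preimage (f := fun x : ℝ => (x : ℂ) * Complex.I) ?_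
    intro x _ y _ hxy
    exact Complex.ofReal_injective (mul_right_cancel₀ Complex.I_ne_zero hxy)
  have hne : E.Nonempty := by
    set K := (frameForm At)ᵀ.map (fun y : ℝ => (y : ℂ)) with hK
    -- K is real and skew, so iK is Hermitian. If iKw = λw then Kw = (-λ)i w, so -λ lies in E, which
    -- is therefore nonempty.
    have hH : (Complex.I • K).IsHermitian := by
      have hskew (i j : HIdx n) : frameForm At i j = -frameForm At j i :=
        congrFun (congrFun (frameForm_transpose At) j) i
      ext i j
      simp [hK, hskew i j]
    let i : HIdx n := Sum.inl ⟨0, hn⟩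
    have hv := hH.mulVec_eigenvectorBasis i
    refine ⟨-hH.eigenvalues i, (hasEigenvalue_jMatrix_iff hAt _).2
      ⟨hH.eigenvectorBasis i, fun h0 => ?_, ?_⟩⟩
    · exact hH.eigenvectorBasis.orthonormal.ne_zero i (PiLp.ext fun j => congrFun h0 j)
    · rw [Matrix.smul_mulVec] at hv
      have h2 := congrArg (fun v => (-Complex.I) • v) hv
      simp only [smul_smul, neg_mul, Complex.I_mul_I, neg_neg, one_smul] at h2
      rw [h2]
      funext j
      simp only [Pi.smul_apply, smul_eq_mul, Complex.real_smul]
      push_cast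
      ring
  obtain ⟨d, hd, hmax⟩ := Set.exists_max_image E id hfin hne
  refine ⟨d, ⟨hd, fun x hx => hmax x hx⟩, ?_⟩
  obtain ⟨w, hw0, hw⟩ := (hasEigenvalue_jMatrix_iff hAt _).1 hd
  have := norm_eigenvalue_le_formNorm hw0 hw
  rw [norm_mul, Complex.norm_I, mul_one, Complex.norm_real] at this
  exact (le_abs_self d).trans this

/-! ### Choice of the constants and conclusion -/

theorem IsWeakCanonicalFormOf.exists_isReduction {n : ℕ} {A : Matrix (Idx n) (Idx n) ℝ}
    {At : Matrix (HIdx n) (HIdx n) ℝ} {ρ : ℝ} (h : IsWeakCanonicalFormOf A At ρ)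
    (hA : A ∈ metricMatrices n 0 ∪ metricMatrices n 1) : ∃ P R, IsReduction A P R At ρ := by
  obtain ⟨hdet, P, R, hP, hR, heq⟩ := h
  refine ⟨P, R, hdet, exists_of_isInnerDifferential hP, hR, heq, ?_⟩
  rcases hA with ⟨⟨I, -, hI⟩, -⟩ | ⟨⟨I, -, hI⟩, -⟩ <;> exact ⟨I, hI⟩

end HeisenbergModuli

theorem proposition6p3 (n : ℕ) (hn : 0 < n) (r : Fin n → ℕ) (hr : HeisenbergModuli.IsLatticeType r)
    (D V : ℝ) (hD : 0 < D) (hV : 0 < V) :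
    ∃ C₁ C₂ C₃ Cp : ℝ, 0 < C₁ ∧ 0 < C₂ ∧ 0 < C₃ ∧ 0 < Cp ∧
      ∀ A ∈ HeisenbergModuli.metricMatrices n 0 ∪ HeisenbergModuli.metricMatrices n 1,
        HeisenbergModuli.diameter A r ≤ ENNReal.ofReal D →
        ENNReal.ofReal V ≤ HeisenbergModuli.totalMinPopp A r →
        ∀ (At : Matrix (HeisenbergModuli.HIdx n) (HeisenbergModuli.HIdx n) ℝ) (ρ : ℝ),
          HeisenbergModuli.IsWeakCanonicalFormOf A At ρ →
          (∃ m : ℝ, IsLeast {x : ℝ | ∃ X ∈ HeisenbergModuli.projLattice r, X ≠ 0 ∧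
              x = HeisenbergModuli.metricNorm (HeisenbergModuli.weakCanonical At ρ)
                (HeisenbergModuli.horizIncl X)} m ∧ C₁ ≤ m) ∧
          C₂ ≤ |At.det| ∧
          (∃ (j : Matrix (HeisenbergModuli.HIdx n) (HeisenbergModuli.HIdx n) ℝ) (d : ℝ),
            HeisenbergModuli.IsJOperator (HeisenbergModuli.weakCanonical At ρ) j ∧
            HeisenbergModuli.IsTopFrequency j d ∧ d ≤ C₃) ∧
          |ρ| ≤ Cp := by
  have hr0 : ∀ i, 0 < r i := hr.1
  set K : ℝ := (HeisenbergModuli.haar n (HeisenbergModuli.coveringBox r)).toReal with hK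
  have hK0 : 0 ≤ K := ENNReal.toReal_nonneg
  set q : ℝ := (Fintype.card (HeisenbergModuli.HIdx n)).factorial •
    (3 * (2 * D)) ^ Fintype.card (HeisenbergModuli.HIdx n) with hq
  have hq0 : 0 < q := by
    rw [hq, nsmul_eq_mul]
    have := Nat.factorial_pos (Fintype.card (HeisenbergModuli.HIdx n))
    positivity
  -- K q / V is the real bound on |ρ| and ‖ω‖; the added 1 only ensures positivity.
  set C : ℝ := K * q / V + 1 with hC
  have hC0 : 0 < C := by positivity
  refine ⟨1 / (C * (3 * (2 * D))), 1 / q, C, C, by positivity, by positivity, hC0, hC0, ?_⟩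
  intro A hA hdiam hvol At ρ hAt
  obtain ⟨P, R, h⟩ := hAt.exists_isReduction hA
  have hcov := h.exists_frameNorm_sub_lt (by positivity) (by linarith : D < 2 * D) hdiam
  have h2D : 0 < 2 * D := by positivity
  have hdet : 1 ≤ |At.det| * q := HeisenbergModuli.one_le_abs_det_mul h.det_ne_zero h2D hcov
  have hs : 0 < HeisenbergModuli.formNorm At := HeisenbergModuli.formNorm_pos hn h.det_ne_zero
  have hVK : V ≤ HeisenbergModuli.minPoppDensity A * K := by
    have h1 := hvol.trans (HeisenbergModuli.totalMinPopp_le hr0 A)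
    rw [← ENNReal.ofReal_toReal (HeisenbergModuli.haar_coveringBox_lt_top r).ne, ← hK,
      ← ENNReal.ofReal_mul' hK0] at h1
    exact (ENNReal.ofReal_le_ofReal_iff' .. |>.1 h1).resolve_right (not_le.2 hV)
  -- Common to both competitors, with x = ‖ω‖ and x = |ρ|: the volume gives V |det Ã| x ≤ K, and 1 ≤
  -- |det Ã| q removes the determinant.
  have key : ∀ x : ℝ, 0 ≤ x → HeisenbergModuli.minPoppDensity A * (|At.det| * x) ≤ 1 → x ≤ C := by
    intro x hx hx1
    have h1 : x ≤ |At.det| * q * x := le_mul_of_one_le_left hx hdet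
    have h2 : V * (|At.det| * x) ≤ K := by
      calc V * (|At.det| * x) ≤ HeisenbergModuli.minPoppDensity A * K * (|At.det| * x) := by gcongr
        _ = K * (HeisenbergModuli.minPoppDensity A * (|At.det| * x)) := by ring
        _ ≤ K * 1 := by gcongr
        _ = K := mul_one K
    have h3 : x ≤ K * q / V := by
      rw [le_div_iff₀ hV]
      calc x * V ≤ |At.det| * q * x * V := by gcongr
        _ = V * (|At.det| * x) * q := by ring
        _ ≤ K * q := by gcongr
    linarith
  have hsC : HeisenbergModuli.formNorm At ≤ C :=
    key _ hs.le (h.minPoppDensity_mul_formNorm_le hs)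
  refine ⟨?_, ?_, ?_, key _ (abs_nonneg ρ) h.minPoppDensity_mul_abs_le⟩
  · obtain ⟨x, hx, hx0, hmin⟩ := HeisenbergModuli.exists_isLeast_frameNorm hn r h.det_ne_zero
    refine ⟨HeisenbergModuli.frameNorm At x, ⟨⟨x, hx, hx0, ?_⟩, ?_⟩, ?_⟩
    · rw [HeisenbergModuli.metricNorm_weakCanonical h.det_ne_zero]
    · rintro _ ⟨y, hy, hy0, rfl⟩
      rw [HeisenbergModuli.metricNorm_weakCanonical h.det_ne_zero]
      exact hmin y hy hy0
    · rw [div_le_iff₀ (by positivity)]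
      have h1 := HeisenbergModuli.one_le_formNorm_mul h.det_ne_zero h2D hcov hx hx0
      have hx1 : 0 ≤ HeisenbergModuli.frameNorm At x := Real.sqrt_nonneg _
      calc 1 ≤ HeisenbergModuli.formNorm At * HeisenbergModuli.frameNorm At x * (3 * (2 * D)) := h1
        _ ≤ C * HeisenbergModuli.frameNorm At x * (3 * (2 * D)) := by gcongr
        _ = _ := by ring
  · rwa [div_le_iff₀ hq0]
  · obtain ⟨d, hd, hds⟩ := HeisenbergModuli.exists_isTopFrequency hn h.det_ne_zero
    exact ⟨HeisenbergModuli.jMatrix At, d, HeisenbergModuli.isJOperator_jMatrix h.det_ne_zero ρ, hd,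
      hds.trans hsC⟩
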